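/- \textbf{Lemma (strengthened Cauchy--Schwarz inequalities).} Let $d\ge 1$ and let $\Omega\subset\mathbb{R}^d$ be a (nonempty) bounded, convex, polyhedral domain. Let $J\ge 1$, $\gamma\in(0,1)$, $\rho,\sigma>0$, and let $\mathcal{T}_1,\dots,\mathcal{T}_J$ be conforming triangulations of $\Omega$ into finitely many $d$-simplices such that, for every $1\le l\le J$, with $h_\tau$ and $r_\tau$ the diameter and inradius of an element $\tau$ and $h_l=\max_{\tau\in\mathcal{T}_l}h_\tau$: (i) $\mathcal{T}_l$ is $(\rho,\sigma)$-quasi-uniform, i.e. $h_\tau\le\rho\, r_\tau$ and $\sigma h_l\le h_\tau\le h_l$ for all $\tau\in\mathcal{T}_l$; (ii) for every vertex $a$ of $\mathcal{T}_l$, the vertex patch $\omega_a$ (the interior of the union of the closed elements of $\mathcal{T}_l$ having $a$ as a vertex) is convex; (iii) $\mathcal{T}_l$ is a refinement of $\mathcal{T}_{l-1}$ if $l\ge 2$; (iv) $c_1\gamma^{2l}\le h_l\le c_2\gamma^{2l}$, where $c_1,c_2>0$ are fixed constants. Let $V_l$ be the space of continuous functions on $\overline\Omega$ that vanish on $\partial\Omega$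 and are affine on each element of $\mathcal{T}_l$ (equivalently, the functions of $H^1_0(\Omega)$ that are affine on each element), let $Q_l\colon V_J\to V_l$ be the $L^2(\Omega)$-orthogonal projection, and let $Q_0=0$. Write $|v|_{H^1(\Omega)}=\bigl(\int_\Omega|\nabla v|^2\,dx\bigr)^{1/2}$, and $\mathcal{R}(\cdot)$ for the range of an operator. Then there is a constant $C>0$ depending only on $c_1,c_2$ (in particular independent of $d,\Omega,\rho,\sigma,\gamma,J,l,k$ and of the triangulations) such that for all $1\le l\le k\le J$, \[ \int_\Omega\nabla v\cdot\nabla w\,dx\le C\,\rho^{3/2}\sigma^{-3/2}d^{3}\gamma^{k-l-2}\,|v|_{H^1(\Omega)}|w|_{H^1(\Omega)}, \qquad v\in\mathcal{R}(Q_l-Q_{l-1}),\ w\in\mathcal{R}(Q_k-Q_{k-1}). \] -/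

import Mathlib

open MeasureTheory Set

noncomputable section

namespace BPX

/-- `ℝ^d` with the Euclidean norm. -/
abbrev E (d : ℕ) : Type := EuclideanSpace ℝ (Fin d)

/-- A (nonempty) bounded, convex, polyhedral domain in `ℝ^d`: an open, nonempty, convex, bounded set
whose closure is a polytope. -/
structure ConvexPolyhedralDomain (d : ℕ) where
  carrier : Set (E d)
  isOpen : IsOpen carrier
  nonempty : carrier.Nonempty
  isBounded : Bornology.IsBounded carrier
  convex : Convex ℝ carrier
  polyhedral : ∃ s : Finset (E d), closure carrier = convexHull ℝ (s : Set (E d))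

/-- A `d`-simplex in `ℝ^d`, given by its (ordered) affinely independent vertices. The open simplex is
`τ.interior`, the closed one is `τ.closedInterior`. -/
abbrev Cell (d : ℕ) : Type := Affine.Simplex ℝ (E d) d

/-- The set of vertices of a simplex. -/
def Cell.vertices {d : ℕ} (τ : Cell d) : Set (E d) := Set.range τ.points

/-- A conforming triangulation of `Ω`: finitely many pairwise disjoint open `d`-simplices whose closures
cover the closure of `Ω`, two closed simplices meeting exactly in the (possibly empty) common face
spanned by their common vertices. -/
structure Triangulation {d : ℕ} (Ω : ConvexPolyhedralDomain d) where
  cells : Finset (Cell d)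
  disjoint : ∀ τ ∈ cells, ∀ τ' ∈ cells, τ ≠ τ' → Disjoint τ.interior τ'.interior
  conforming : ∀ τ ∈ cells, ∀ τ' ∈ cells,
    τ.closedInterior ∩ τ'.closedInterior = convexHull ℝ (Cell.vertices τ ∩ Cell.vertices τ')
  cover : closure Ω.carrier = ⋃ τ ∈ cells, τ.closedInterior

namespace Triangulation

variable {d : ℕ} {Ω : ConvexPolyhedralDomain d}

/-- The diameter `h_τ` of a simplex. -/
def cellDiam (τ : Cell d) : ℝ := Metric.diam τ.closedInterior

/-- The mesh size `h = max_τ h_τ`. -/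
def meshSize (T : Triangulation Ω) : ℝ := ⨆ τ : T.cells, cellDiam τ.1

/-- `(ρ, σ)`-quasi-uniformity: `h_τ ≤ ρ r_τ` and `σ h ≤ h_τ ≤ h` for all elements, where `r_τ` is the
inradius. -/
def IsQuasiUniform [NeZero d] (T : Triangulation Ω) (ρ σ : ℝ) : Prop :=
  0 < ρ ∧ 0 < σ ∧ ∀ τ ∈ T.cells, cellDiam τ ≤ ρ * τ.inradius ∧
    σ * T.meshSize ≤ cellDiam τ ∧ cellDiam τ ≤ T.meshSize

/-- The set of all vertices of the triangulation. -/
def vertices (T : Triangulation Ω) : Set (E d) := ⋃ τ ∈ T.cells, Cell.vertices τ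

/-- The (open) vertex patch `ω_a`, whose closure is the union of the closed elements that have `a` as
a vertex. -/
def vertexPatch (T : Triangulation Ω) (a : E d) : Set (E d) :=
  interior (⋃ τ ∈ {τ : Cell d | τ ∈ T.cells ∧ a ∈ Cell.vertices τ}, τ.closedInterior)

/-- `T'` is a refinement of `T`: every element of `T'` lies in an element of `T`. -/
def IsRefinement (T' T : Triangulation Ω) : Prop :=
  ∀ τ' ∈ T'.cells, ∃ τ ∈ T.cells, τ'.closedInterior ⊆ τ.closedInterior

/-- The space of continuous, piecewise linear functions with zero boundary values (the
piecewise linear functions in `H¹₀(Ω)`). Functions are extended by zero outside `Ω`, so that continuity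
on the closure of `Ω` together with zero boundary values is continuity on `ℝ^d`. -/
def feSpace (T : Triangulation Ω) : Submodule ℝ (E d → ℝ) where
  carrier := {v | Continuous v ∧ (∀ x ∉ Ω.carrier, v x = 0) ∧
    ∀ τ ∈ T.cells, ∃ A : E d →ᵃ[ℝ] ℝ, EqOn v A τ.closedInterior}
  add_mem' := by
    rintro v w ⟨hv, hv0, hvA⟩ ⟨hw, hw0, hwA⟩
    refine ⟨hv.add hw, fun x hx => by simp [hv0 x hx, hw0 x hx], fun τ hτ => ?_⟩
    obtain ⟨A, hA⟩ := hvA τ hτ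
    obtain ⟨B, hB⟩ := hwA τ hτ
    exact ⟨A + B, fun x hx => by simp [hA hx, hB hx]⟩
  zero_mem' := ⟨continuous_const, fun _ _ => rfl, fun _ _ => ⟨0, fun _ _ => rfl⟩⟩
  smul_mem' := by
    rintro c v ⟨hv, hv0, hvA⟩
    refine ⟨hv.const_smul c, fun x hx => by simp [hv0 x hx], fun τ hτ => ?_⟩
    obtain ⟨A, hA⟩ := hvA τ hτ
    exact ⟨c • A, fun x hx => by simp [hA hx]⟩

theorem memLp_of_mem_feSpace (T : Triangulation Ω) {v : E d → ℝ} (hv : v ∈ T.feSpace) :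
    MemLp v 2 (volume.restrict Ω.carrier) := by
  have hc : IsCompact (closure Ω.carrier) := Ω.isBounded.isCompact_closure
  have : IsFiniteMeasure (volume.restrict Ω.carrier) :=
    ⟨by simpa using (measure_mono subset_closure).trans_lt hc.measure_lt_top⟩
  obtain ⟨C, hC⟩ := hc.exists_bound_of_continuousOn hv.1.continuousOn
  refine MemLp.of_bound hv.1.aestronglyMeasurable C ?_
  filter_upwards [ae_restrict_mem Ω.isOpen.measurableSet] with x hx
  exact hC x (subset_closure hx)

/-- The class in `L²(Ω)` of a finite element function. -/
def toL2 (T : Triangulation Ω) : T.feSpace →ₗ[ℝ] Lp ℝ 2 (volume.restrict Ω.carrier) where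
  toFun v := (T.memLp_of_mem_feSpace v.2).toLp v.1
  map_add' _ _ := rfl
  map_smul' _ _ := rfl

theorem toL2_injective (T : Triangulation Ω) : Function.Injective T.toL2 := by
  intro v w h
  have h' : v.1 =ᵐ[volume.restrict Ω.carrier] w.1 := 
    (MemLp.toLp_eq_toLp_iff (T.memLp_of_mem_feSpace v.2) (T.memLp_of_mem_feSpace w.2)).1 h
  have h'' := Measure.eqOn_open_of_ae_eq h' Ω.isOpen v.2.1.continuousOn w.2.1.continuousOn
  ext x
  by_cases hx : x ∈ Ω.carrier
  · exact h'' hx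
  · rw [v.2.2.1 x hx, w.2.2.1 x hx]

instance finite_feSpace (T : Triangulation Ω) : Module.Finite ℝ T.feSpace := by
  let N : T.feSpace →ₗ[ℝ] (T.cells → Fin (d + 1) → ℝ) :=
    { toFun := fun v τ i => v.1 (τ.1.points i)
      map_add' := fun _ _ => rfl
      map_smul' := fun _ _ => rfl }
  refine Module.Finite.of_injective N ((injective_iff_map_eq_zero N).2 fun v hv => ?_)
  ext x
  by_cases hx : x ∈ Ω.carrier
  · have hx' : x ∈ ⋃ τ ∈ T.cells, τ.closedInterior := T.cover ▸ subset_closure hx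
    simp only [mem_iUnion] at hx'
    obtain ⟨τ, hτ, hxτ⟩ := hx'
    obtain ⟨A, hA⟩ := v.2.2.2 τ hτ
    have hpt : ∀ i, A (τ.points i) = 0 := fun i => by
      rw [← hA (τ.point_mem_closedInterior i)]
      exact congrFun (congrFun hv ⟨τ, hτ⟩) i
    have hsub : convexHull ℝ (Set.range τ.points) ⊆ A ⁻¹' {0} := by
      refine convexHull_min ?_ ((convex_singleton (0 : ℝ)).affine_preimage A)
      rintro _ ⟨i, rfl⟩
      exact hpt i
    rw [Affine.Simplex.convexHull_eq_closedInterior] at hsub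
    exact (hA hxτ).trans (hsub hxτ)
  · exact v.2.2.1 x hx

/-- The `L²(Ω)`-orthogonal projection onto the finite element space. -/
def l2Proj (T : Triangulation Ω) : Lp ℝ 2 (volume.restrict Ω.carrier) →ₗ[ℝ] T.feSpace :=
  (LinearEquiv.ofInjective T.toL2 T.toL2_injective).symm.toLinearMap ∘ₗ
    (LinearMap.range T.toL2).orthogonalProjectionOnto.toLinearMap

/-- The defining property of the `L²(Ω)`-orthogonal projection. -/
theorem integral_l2Proj_mul (T T' : Triangulation Ω) (u : T'.feSpace) (v : T.feSpace) :
    ∫ x in Ω.carrier, (T.l2Proj (T'.toL2 u)).1 x * v.1 x = ∫ x in Ω.carrier, u.1 x * v.1 x := by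
  have key : ∀ (S S' : Triangulation Ω) (f : S.feSpace) (g : S'.feSpace),
      inner ℝ (S.toL2 f) (S'.toL2 g) = ∫ x in Ω.carrier, f.1 x * g.1 x := by
    intro S S' f g
    rw [L2.inner_def]
    refine integral_congr_ae ?_
    filter_upwards [(S.memLp_of_mem_feSpace f.2).coeFn_toLp,
      (S'.memLp_of_mem_feSpace g.2).coeFn_toLp] with x hf hg
    change inner ℝ ((S.memLp_of_mem_feSpace f.2).toLp f.1 x)
      ((S'.memLp_of_mem_feSpace g.2).toLp g.1 x) = _
    rw [hf, hg]
    simp [mul_comm]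
  have hp : T.toL2 (T.l2Proj (T'.toL2 u)) =
      ((LinearMap.range T.toL2).orthogonalProjectionOnto (T'.toL2 u) : Lp ℝ 2 _) := by
    have := (LinearEquiv.ofInjective T.toL2 T.toL2_injective).apply_symm_apply
      ((LinearMap.range T.toL2).orthogonalProjectionOnto (T'.toL2 u))
    exact congrArg Subtype.val this
  rw [← key, ← key, hp]
  have := Submodule.starProjection_inner_eq_zero (K := LinearMap.range T.toL2)
    (T'.toL2 u) (T.toL2 v) ⟨v, rfl⟩
  rw [inner_sub_left] at this
  exact (sub_eq_zero.1 this).symm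

end Triangulation

variable {d : ℕ} {Ω : ConvexPolyhedralDomain d}

/-- For a family of levels `T 1, …, T J`, the `L²`-orthogonal projection `Q_l : V_J → V_l` (with values
regarded as functions), with the convention `Q_0 = 0`. -/
def levelProj (T : ℕ → Triangulation Ω) (J l : ℕ) : (T J).feSpace →ₗ[ℝ] (E d → ℝ) :=
  if l = 0 then 0 else (T l).feSpace.subtype ∘ₗ (T l).l2Proj ∘ₗ (T J).toL2

/-- The range of `Q_l - Q_{l-1}` (used for `1 ≤ l`). -/
def levelRange (T : ℕ → Triangulation Ω) (J l : ℕ) : Submodule ℝ (E d → ℝ) :=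
  LinearMap.range (levelProj T J l - levelProj T J (l - 1))

/-- `∫_Ω ∇v · ∇w dx`; for piecewise linear continuous functions the pointwise gradient exists almost
everywhere and is the weak gradient. -/
def dirichletForm (Ω : ConvexPolyhedralDomain d) (v w : E d → ℝ) : ℝ :=
  ∫ x in Ω.carrier, inner ℝ (gradient v x) (gradient w x)

/-- The seminorm `|v|_{H¹(Ω)} = (∫_Ω |∇v|² dx)^{1/2}`. -/
def h1Seminorm (Ω : ConvexPolyhedralDomain d) (v : E d → ℝ) : ℝ :=
  √(∫ x in Ω.carrier, ‖gradient v x‖ ^ 2)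

/-- The triangulation satisfies the geometric assumption with parameters `ρ, σ`: it is
`(ρ, σ)`-quasi-uniform and all its vertex patches are convex. -/
def IsAdmissible [NeZero d] (T : Triangulation Ω) (ρ σ : ℝ) : Prop :=
  T.IsQuasiUniform ρ σ ∧ ∀ a ∈ T.vertices, Convex ℝ (T.vertexPatch a)

/-- The multilevel assumption for `T 1, …, T J`: successive refinement, and mesh sizes
`c₁ γ^{2l} ≤ h_l ≤ c₂ γ^{2l}`. -/
def IsMultilevel (T : ℕ → Triangulation Ω) (J : ℕ) (γ c₁ c₂ : ℝ) : Prop :=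
  (∀ l, 2 ≤ l → l ≤ J → (T l).IsRefinement (T (l - 1))) ∧
  ∀ l, 1 ≤ l → l ≤ J →
    c₁ * γ ^ (2 * l) ≤ (T l).meshSize ∧ (T l).meshSize ≤ c₂ * γ ^ (2 * l)

end BPX

end

namespace BPX

/-! ### Midpoint Prékopa–Leindler inequality: from the line to `E d` -/

section PrekopaLeindler

open scoped ENNReal

/-! The gain comes from the difference of scales: `w` is small in `L²` compared with its gradient,
while `∇v` is constant on the elements of the coarser mesh. For `l = k` Cauchy–Schwarz suffices,
because `γ ^ (-2) ≥ 1`.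

Let `l < k`. Then `w` is `L²`-orthogonal to `V_{k-1}`, so `‖w‖ ≤ ‖w - z‖` for every `z ∈ V_{k-1}`. A
quasi-interpolant `z` gives `‖w‖ ≤ s |w|_{H¹}` with `s = 3 d h_{k-1}`
(`sqrt_integral_sq_le_of_mem_levelRange`). On an element of `T_l` with inradius `r > s`, a cutoff
`η` splits `∫ p · ∇w`, where `p = ∇v`. The part with `1 - η` lives in a boundary strip of relative
volume at most `d s / r`; in the other part, integration by parts moves the derivative onto `η`,
whose derivative lives in the same strip and is at most `1 / s`. Cauchy–Schwarz yields the factor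
`√(d s / r)` (`integral_inner_gradient_le`), and summing over elements gives
`Triangulation.dirichletForm_le`. Since `r ≥ σ h_l / ρ` and `h_{k-1} / h_l ≤ (c₂ / c₁) γ ^ (2
(k-1-l))`, the square root is of order `d √(ρ / σ) γ ^ (k-l-1)`, which is stronger than required.

The approximation estimate must not hide a dimension-dependent constant. The nodal value of `z` at
an interior vertex is a constant from a Poincaré inequality on the convex vertex patch; at boundary
vertices it is zero. The Poincaré constant `2 h²` comes from Prékopa–Leindler: a Gaussian weight on
a convex set gives an exponential inequality for infimum convolutions, whose second-order expansion
is a variance bound. Elements touching the boundary are handled by a Friedrichs inequality in a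
strip, with constant `h²` whatever the number of hyperplanes, by integrating towards the nearest
one. -/

theorem volume_add_le_of_isCompact {A B C : Set ℝ} (hA : IsCompact A) (hB : IsCompact B)
    (hA' : A.Nonempty) (hB' : B.Nonempty) (h : ∀ a ∈ A, ∀ b ∈ B, a + b ∈ C) :
    volume A + volume B ≤ volume C := by
  have ha := hA.isGreatest_sSup hA'
  have hb := hB.isLeast_sInf hB'
  set a := sSup A
  set b := sInf B
  have h1 : volume ((· + b) '' A) = volume A := by
    rw [image_add_right, measure_preimage_add_right]
  have h2 : volume ((a + ·) '' B) = volume B := by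
    rw [image_add_left, measure_preimage_add]
  have hBm : MeasurableSet ((a + ·) '' B) :=
    (hB.image (continuous_const.add continuous_id)).measurableSet
  -- The translates `A + min B` and `max A + B` both lie in `C` and overlap in at most the single
  -- point `max A + min B`.
  have hinter : volume (((· + b) '' A) ∩ ((a + ·) '' B)) = 0 := by
    refine measure_mono_null (t := {a + b}) ?_ (measure_singleton _)
    rintro _ ⟨⟨x, hx, rfl⟩, ⟨y, hy, hxy⟩⟩
    have := ha.2 hx
    have := hb.2 hy
    simp only [mem_singleton_iff] at *
    linarith
  rw [← h1, ← h2, ← measure_union_add_inter _ hBm, hinter, add_zero]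
  refine measure_mono (union_subset ?_ ?_)
  · rintro _ ⟨x, hx, rfl⟩
    exact h x hx b hb.1
  · rintro _ ⟨y, hy, rfl⟩
    exact h a ha.1 y hy

/-- The one-dimensional Brunn–Minkowski inequality, for midpoints. -/
theorem volume_add_le_two_mul_volume {A B C : Set ℝ} (hA : MeasurableSet A) (hB : MeasurableSet B)
    (hA' : A.Nonempty) (hB' : B.Nonempty) (h : ∀ a ∈ A, ∀ b ∈ B, (a + b) / 2 ∈ C) :
    volume A + volume B ≤ 2 * volume C := by
  obtain ⟨a, ha⟩ := hA'
  obtain ⟨b, hb⟩ := hB'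
  have hC : volume ((fun x : ℝ => 2 * x) '' C) = 2 * volume C := by
    have := Measure.addHaar_smul (volume : Measure ℝ) 2 C
    rw [Module.finrank_self, pow_one, abs_two, ENNReal.ofReal_ofNat] at this
    exact this
  rw [← hC]
  rw [hA.measure_eq_iSup_isCompact, hB.measure_eq_iSup_isCompact]
  simp only [iSup_and', iSup_subtype']
  have hne : ∀ A : Set ℝ, Nonempty {K : Set ℝ // K ⊆ A ∧ IsCompact K} := fun A =>
    ⟨∅, empty_subset _, isCompact_empty⟩
  refine ENNReal.iSup_add_iSup_le ?_
  rintro ⟨K, hKA, hK⟩ ⟨L, hLB, hL⟩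
  -- The inner approximating compacts may be empty; adjoining `a` and `b` makes them nonempty
  -- without leaving `A` and `B`.
  refine (add_le_add (measure_mono (subset_insert a K))
    (measure_mono (subset_insert b L))).trans ?_
  refine volume_add_le_of_isCompact (hK.insert a) (hL.insert b) (insert_nonempty ..)
    (insert_nonempty ..) fun x hx y hy => ?_
  exact ⟨(x + y) / 2, h x (insert_subset ha hKA hx) y (insert_subset hb hLB hy), by ring⟩

/-- Layer-cake formula plus one-dimensional Brunn–Minkowski on the superlevel sets. Brunn–Minkowski
needs both sets nonempty, which is why the two suprema are normalised to the same value 1: below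
level 1 both sets are nonempty, from level 1 on both are empty. -/
theorem lintegral_add_le_of_normalized {u v w : ℝ → ℝ} (hu : Measurable u) (hv : Measurable v)
    (hw : Measurable w) (hu0 : ∀ x, 0 ≤ u x) (hv0 : ∀ x, 0 ≤ v x) (hw0 : ∀ x, 0 ≤ w x)
    (hu1 : ∀ x, u x ≤ 1) (hv1 : ∀ x, v x ≤ 1) (hus : ∀ t < 1, ∃ x, t < u x)
    (hvs : ∀ t < 1, ∃ x, t < v x)
    (h : ∀ t, 0 < t → ∀ x y, t < u x → t < v y → t < w ((x + y) / 2)) :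
    (∫⁻ x, ENNReal.ofReal (u x)) + ∫⁻ x, ENNReal.ofReal (v x) ≤
      2 * ∫⁻ x, ENNReal.ofReal (w x) := by
  rw [lintegral_eq_lintegral_meas_lt volume (ae_of_all _ hu0) hu.aemeasurable,
    lintegral_eq_lintegral_meas_lt volume (ae_of_all _ hv0) hv.aemeasurable,
    lintegral_eq_lintegral_meas_lt volume (ae_of_all _ hw0) hw.aemeasurable]
  have hanti : ∀ f : ℝ → ℝ, Measurable fun t => volume {a : ℝ | t < f a} := fun f =>
    Antitone.measurable fun s t hst => measure_mono fun x hx => lt_of_le_of_lt hst hx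
  rw [← lintegral_add_left (hanti u), ← lintegral_const_mul _ (hanti w)]
  refine setLIntegral_mono' measurableSet_Ioi fun t (ht : 0 < t) => ?_
  rcases lt_or_ge t 1 with ht1 | ht1
  · exact volume_add_le_two_mul_volume (measurableSet_lt measurable_const hu)
      (measurableSet_lt measurable_const hv) (hus t ht1) (hvs t ht1)
      fun x hx y hy => h t ht x y hx hy
  · have e1 : {a | t < u a} = ∅ := eq_empty_of_forall_notMem fun x hx =>
      absurd (lt_of_le_of_lt ht1 hx) (not_lt.2 (hu1 x))
    have e2 : {a | t < v a} = ∅ := eq_empty_of_forall_notMem fun x hx =>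
      absurd (lt_of_le_of_lt ht1 hx) (not_lt.2 (hv1 x))
    simp [e1, e2]

/-- Scaling `u`, `v` by their suprema `α`, `β` and `w` by `√(αβ)` preserves the pointwise
hypothesis; the additive bound of the normalised case becomes multiplicative by `4xy ≤ (x + y)²`. -/
theorem prekopaLeindler_of_bounded {u v w : ℝ → ℝ} (hu : Measurable u) (hv : Measurable v)
    (hw : Measurable w) (hu0 : ∀ x, 0 ≤ u x) (hv0 : ∀ x, 0 ≤ v x) (hw0 : ∀ x, 0 ≤ w x)
    (hub : BddAbove (range u)) (hvb : BddAbove (range v))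
    (h : ∀ x y, u x * v y ≤ w ((x + y) / 2) ^ 2) :
    (∫⁻ x, ENNReal.ofReal (u x)) * ∫⁻ x, ENNReal.ofReal (v x) ≤
      (∫⁻ x, ENNReal.ofReal (w x)) ^ 2 := by
  set α := ⨆ x, u x
  set β := ⨆ x, v x
  have hα : ∀ x, u x ≤ α := fun x => le_ciSup hub x
  have hβ : ∀ x, v x ≤ β := fun x => le_ciSup hvb x
  rcases (hu0 0).trans (hα 0) |>.eq_or_lt with hα0 | hα0
  · have : ∀ x, u x = 0 := fun x => le_antisymm ((hα x).trans hα0.symm.le) (hu0 x)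
    simp [this]
  rcases (hv0 0).trans (hβ 0) |>.eq_or_lt with hβ0 | hβ0
  · have : ∀ x, v x = 0 := fun x => le_antisymm ((hβ x).trans hβ0.symm.le) (hv0 x)
    simp [this]
  set δ := √(α * β)
  have hδ : 0 < δ := Real.sqrt_pos.2 (mul_pos hα0 hβ0)
  have hδ2 : δ ^ 2 = α * β := Real.sq_sqrt (mul_pos hα0 hβ0).le
  have key := lintegral_add_le_of_normalized (hu.div_const α) (hv.div_const β) (hw.div_const δ)
    (fun x => div_nonneg (hu0 x) hα0.le) (fun x => div_nonneg (hv0 x) hβ0.le)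
    (fun x => div_nonneg (hw0 x) hδ.le) (fun x => (div_le_one hα0).2 (hα x))
    (fun x => (div_le_one hβ0).2 (hβ x))
    (fun t ht => by
      obtain ⟨x, hx⟩ := exists_lt_of_lt_ciSup (show t * α < ⨆ x, u x from by
        change t * α < α
        nlinarith)
      exact ⟨x, (lt_div_iff₀ hα0).2 hx⟩)
    (fun t ht => by
      obtain ⟨x, hx⟩ := exists_lt_of_lt_ciSup (show t * β < ⨆ x, v x from by
        change t * β < β
        nlinarith)
      exact ⟨x, (lt_div_iff₀ hβ0).2 hx⟩)
    (fun t ht x y hx hy => by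
      rw [lt_div_iff₀ hα0] at hx
      rw [lt_div_iff₀ hβ0] at hy
      rw [lt_div_iff₀ hδ]
      refine lt_of_pow_lt_pow_left₀ 2 (hw0 _) (lt_of_lt_of_le ?_ (h x y))
      calc (t * δ) ^ 2 = (t * α) * (t * β) := by rw [mul_pow, hδ2]; ring
        _ < u x * v y := mul_lt_mul'' hx hy (by positivity) (by positivity))
  have hdiv : ∀ (f : ℝ → ℝ) (c : ℝ), 0 < c → ∫⁻ x, ENNReal.ofReal (f x / c) =
      ENNReal.ofReal c⁻¹ * ∫⁻ x, ENNReal.ofReal (f x) := by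
    intro f c hc
    rw [← lintegral_const_mul' _ _ ENNReal.ofReal_ne_top]
    refine lintegral_congr fun x => ?_
    rw [← ENNReal.ofReal_mul (inv_pos.2 hc).le, div_eq_inv_mul]
  rw [hdiv u α hα0, hdiv v β hβ0, hdiv w δ hδ] at key
  generalize (∫⁻ x, ENNReal.ofReal (u x)) = U at *
  generalize (∫⁻ x, ENNReal.ofReal (v x)) = V at *
  generalize (∫⁻ x, ENNReal.ofReal (w x)) = W at *
  by_cases hW : W = ∞
  · simp [hW]
  have hR : 2 * (ENNReal.ofReal δ⁻¹ * W) ≠ ∞ :=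
    ENNReal.mul_ne_top (by simp) (ENNReal.mul_ne_top ENNReal.ofReal_ne_top hW)
  have hU : U ≠ ∞ := by
    rintro rfl
    rw [ENNReal.mul_top (by simpa using hα0), top_add] at key
    exact hR (top_le_iff.1 key)
  have hV : V ≠ ∞ := by
    rintro rfl
    rw [ENNReal.mul_top (by simpa using hβ0), add_top] at key
    exact hR (top_le_iff.1 key)
  lift U to NNReal using hU
  lift V to NNReal using hV
  lift W to NNReal using hW
  rw [ENNReal.ofReal, ENNReal.ofReal, ENNReal.ofReal] at key
  norm_cast at key ⊢
  rw [← NNReal.coe_le_coe] at key ⊢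
  push_cast [Real.coe_toNNReal _ (inv_pos.2 hα0).le, Real.coe_toNNReal _ (inv_pos.2 hβ0).le,
    Real.coe_toNNReal _ (inv_pos.2 hδ).le] at key ⊢
  have h1 : (α⁻¹ * U + β⁻¹ * V) ^ 2 ≤ (2 * (δ⁻¹ * (W : ℝ))) ^ 2 := by gcongr
  have h2 : 4 * ((α⁻¹ * U) * (β⁻¹ * V)) ≤ (α⁻¹ * U + β⁻¹ * (V : ℝ)) ^ 2 := by
    nlinarith [sq_nonneg (α⁻¹ * U - β⁻¹ * (V : ℝ))]
  have h3 : (2 * (δ⁻¹ * (W : ℝ))) ^ 2 = 4 * (α⁻¹ * β⁻¹) * W ^ 2 := by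
    rw [mul_pow, mul_pow, inv_pow, hδ2, mul_inv]; ring
  have h4 : 0 < α⁻¹ * β⁻¹ := by positivity
  nlinarith

/-- The Prékopa–Leindler inequality on the line, for midpoints. -/
theorem prekopaLeindler_real {u v w : ℝ → ℝ≥0∞} (hu : Measurable u) (hv : Measurable v)
    (hw : Measurable w) (h : ∀ x y, u x * v y ≤ w ((x + y) / 2) ^ 2) :
    (∫⁻ x, u x) * ∫⁻ x, v x ≤ (∫⁻ x, w x) ^ 2 := by
  have hfin : ∀ (n : ℕ) (a : ℝ≥0∞), min a n ≠ ∞ := fun n a =>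
    ne_top_of_le_ne_top (ENNReal.natCast_ne_top n) (min_le_right _ _)
  have hof : ∀ (n : ℕ) (a : ℝ≥0∞), ENNReal.ofReal (min a n).toReal = min a n := fun n a =>
    ENNReal.ofReal_toReal (hfin n a)
  have hbd : ∀ (n : ℕ) (f : ℝ → ℝ≥0∞), BddAbove (range fun x => (min (f x) n).toReal) := by
    rintro n f
    refine ⟨n, ?_⟩
    rintro _ ⟨x, rfl⟩
    simpa using ENNReal.toReal_mono (ENNReal.natCast_ne_top n) (min_le_right (f x) n)
  -- Truncating all three functions at the same height keeps the hypothesis: where `w` is cut the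
  -- right side is `n²`, which dominates the truncated product.
  have htrunc : ∀ n : ℕ, (∫⁻ x, min (u x) n) * ∫⁻ x, min (v x) n ≤ (∫⁻ x, w x) ^ 2 := by
    intro n
    have := prekopaLeindler_of_bounded (u := fun x => (min (u x) n).toReal)
      (v := fun x => (min (v x) n).toReal) (w := fun x => (min (w x) n).toReal)
      (hu.min measurable_const).ennreal_toReal (hv.min measurable_const).ennreal_toReal
      (hw.min measurable_const).ennreal_toReal (fun _ => ENNReal.toReal_nonneg)
      (fun _ => ENNReal.toReal_nonneg) (fun _ => ENNReal.toReal_nonneg) (hbd n u) (hbd n v)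
      (fun x y => by
        rw [← ENNReal.toReal_mul, ← ENNReal.toReal_pow]
        refine ENNReal.toReal_mono (ENNReal.pow_ne_top (hfin n _)) ?_
        rcases min_cases (w ((x + y) / 2)) (n : ℝ≥0∞) with hc | hc
        · rw [hc.1]
          exact (mul_le_mul' (min_le_left _ _) (min_le_left _ _)).trans (h x y)
        · rw [hc.1, pow_two]
          exact mul_le_mul' (min_le_right _ _) (min_le_right _ _))
    simp only [hof] at this
    exact this.trans (pow_le_pow_left' (lintegral_mono fun x => min_le_left _ _) 2)
  have hmono : ∀ f : ℝ → ℝ≥0∞, Monotone fun (n : ℕ) x => min (f x) (n : ℝ≥0∞) :=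
    fun f m n hmn x => min_le_min le_rfl (by exact_mod_cast hmn)
  have hsup : ∀ f : ℝ → ℝ≥0∞, Measurable f → ∫⁻ x, f x = ⨆ n : ℕ, ∫⁻ x, min (f x) n := by
    intro f hf
    rw [← lintegral_iSup (fun n => hf.min measurable_const) (hmono f)]
    refine lintegral_congr fun x => ?_
    rw [← inf_iSup_eq, ENNReal.iSup_natCast, inf_top_eq]
  rw [hsup u hu, hsup v hv, ENNReal.iSup_mul]
  refine iSup_le fun m => ?_
  rw [ENNReal.mul_iSup]
  refine iSup_le fun n => le_trans ?_ (htrunc (max m n))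
  exact mul_le_mul' (lintegral_mono (hmono u (le_max_left m n)))
    (lintegral_mono (hmono v (le_max_right m n)))

/-- Induction by slicing: for fixed first coordinates `s`, `t` the slices satisfy the hypothesis in
dimension `n`, so the slice integrals satisfy the hypothesis of the inequality on the line. -/
theorem prekopaLeindler_pi (n : ℕ) {u v w : (Fin n → ℝ) → ℝ≥0∞} (hu : Measurable u)
    (hv : Measurable v) (hw : Measurable w)
    (h : ∀ x y, u x * v y ≤ w ((2 : ℝ)⁻¹ • (x + y)) ^ 2) :
    (∫⁻ x, u x) * ∫⁻ x, v x ≤ (∫⁻ x, w x) ^ 2 := by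
  induction n with
  | zero =>
    have hd : (volume : Measure (Fin 0 → ℝ)) = Measure.dirac 0 := by
      rw [volume_pi]; exact Measure.pi_of_empty _ _
    simp only [hd, lintegral_dirac]
    simpa using h 0 0
  | succ n ih =>
    let e := MeasurableEquiv.piFinSuccAbove (fun _ : Fin (n + 1) => ℝ) 0
    have he : MeasurePreserving e.symm volume volume :=
      (volume_preserving_piFinSuccAbove (fun _ : Fin (n + 1) => ℝ) 0).symm
    have hlin : ∀ p q, e.symm ((2 : ℝ)⁻¹ • (p + q)) = (2 : ℝ)⁻¹ • (e.symm p + e.symm q) := by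
      intro p q
      ext i
      refine Fin.cases ?_ (fun i => ?_) i <;>
        simp [e, MeasurableEquiv.piFinSuccAbove, Fin.insertNthEquiv, mul_add]
    have hint : ∀ f : (Fin (n + 1) → ℝ) → ℝ≥0∞, Measurable f →
        ∫⁻ x, f x = ∫⁻ s : ℝ, ∫⁻ x : Fin n → ℝ, f (e.symm (s, x)) := by
      intro f hf
      rw [← he.lintegral_comp hf]
      exact lintegral_prod _ (hf.comp e.symm.measurable).aemeasurable
    rw [hint u hu, hint v hv, hint w hw]
    have hm : ∀ f : (Fin (n + 1) → ℝ) → ℝ≥0∞, Measurable f →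
        Measurable fun p : ℝ × (Fin n → ℝ) => f (e.symm p) := fun f hf =>
      hf.comp e.symm.measurable
    refine prekopaLeindler_real (hm u hu).lintegral_prod_right' (hm v hv).lintegral_prod_right'
      (hm w hw).lintegral_prod_right' fun s t => ?_
    refine ih ((hm u hu).comp measurable_prodMk_left) ((hm v hv).comp measurable_prodMk_left)
      ((hm w hw).comp measurable_prodMk_left) fun x y => ?_
    have := h (e.symm (s, x)) (e.symm (t, y))
    rw [← hlin] at this
    have h2 : (2 : ℝ)⁻¹ • ((s, x) + (t, y)) = ((s + t) / 2, (2 : ℝ)⁻¹ • (x + y)) := by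
      ext <;> simp <;> ring
    rwa [h2] at this

/-- The Prékopa–Leindler inequality for midpoints. -/
theorem prekopaLeindler {d : ℕ} {u v w : E d → ℝ≥0∞} (hu : Measurable u)
    (hv : Measurable v) (hw : Measurable w)
    (h : ∀ x y, u x * v y ≤ w ((2 : ℝ)⁻¹ • (x + y)) ^ 2) :
    (∫⁻ x, u x) * ∫⁻ x, v x ≤ (∫⁻ x, w x) ^ 2 := by
  let e := MeasurableEquiv.toLp 2 (Fin d → ℝ)
  have he : MeasurePreserving e volume volume :=
    PiLp.volume_preserving_toLp (Fin d)
  rw [← he.lintegral_comp hu, ← he.lintegral_comp hv, ← he.lintegral_comp hw]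
  exact prekopaLeindler_pi d (hu.comp e.measurable) (hv.comp e.measurable)
    (hw.comp e.measurable) fun x y => h (e x) (e y)

end PrekopaLeindler

end BPX

namespace BPX

/-! ### From an exponential inequality to a variance bound -/

section Poincare

open Filter Topology
open scoped NNReal

theorem one_add_add_sub_le_exp {t : ℝ} (ht : |t| ≤ 1) :
    1 + t + t ^ 2 / 2 - |t| ^ 3 ≤ Real.exp t := by
  have h := Real.exp_bound ht (n := 3) (by norm_num)
  simp only [Finset.sum_range_succ, Finset.sum_range_zero, Nat.factorial] at h
  norm_num at h
  have := (abs_le.1 h).1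
  nlinarith [pow_nonneg (abs_nonneg t) 3]

/-- The second-order expansion of an exponential inequality: the linearization which turns
a transport-type inequality into a variance bound. -/
theorem integral_sub_sq_le_of_exp {X : Type*} [MeasurableSpace X] {μ : Measure X}
    [IsProbabilityMeasure μ] {f : X → ℝ} {m : ℝ → X → ℝ} {m₀ : X → ℝ} {B M : ℝ}
    (hf : AEStronglyMeasurable f μ) (hfB : ∀ᵐ x ∂μ, |f x - ∫ y, f y ∂μ| ≤ B)
    (hm : ∀ ε, AEStronglyMeasurable (m ε) μ) (hm0 : ∀ ε > 0, ∀ᵐ x ∂μ, 0 ≤ m ε x)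
    (hmM : ∀ ε > 0, ∀ᵐ x ∂μ, m ε x ≤ M)
    (hlim : ∀ᵐ x ∂μ, Tendsto (fun ε => m ε x) (𝓝[>] 0) (𝓝 (m₀ x)))
    (h : ∀ ε > 0, (∫ x, Real.exp (ε * f x - ε ^ 2 * m ε x) ∂μ) *
      ∫ x, Real.exp (-(ε * f x)) ∂μ ≤ 1) :
    ∫ x, (f x - ∫ y, f y ∂μ) ^ 2 ∂μ ≤ ∫ x, m₀ x ∂μ := by
  set c := ∫ y, f y ∂μ
  set g : X → ℝ := fun x => f x - c
  have hB0 : 0 ≤ B := by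
    obtain ⟨x, hx⟩ := hfB.exists
    exact (abs_nonneg _).trans hx
  have hM0 : 0 ≤ M := by
    obtain ⟨x, hx, hx'⟩ := ((hm0 1 one_pos).and (hmM 1 one_pos)).exists
    exact hx.trans hx'
  have hgm : AEStronglyMeasurable g μ := hf.sub aestronglyMeasurable_const
  have hgi : Integrable g μ := Integrable.of_bound hgm B hfB
  have hfi : Integrable f μ := by
    have := hgi.add (integrable_const c)
    refine this.congr (ae_of_all _ fun x => ?_)
    simp [g]
  have hg0 : ∫ x, g x ∂μ = 0 := by
    rw [integral_sub hfi (integrable_const c)]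
    simp [c]
  have hg2 : Integrable (fun x => g x ^ 2) μ := by
    refine Integrable.of_bound (hgm.pow 2) (B ^ 2) ?_
    filter_upwards [hfB] with x hx
    rw [Real.norm_eq_abs, abs_pow]
    gcongr
  have hmi : ∀ ε > 0, Integrable (m ε) μ := fun ε hε => by
    refine Integrable.of_bound (hm ε) M ?_
    filter_upwards [hm0 ε hε, hmM ε hε] with x hx hx'
    rwa [Real.norm_eq_abs, abs_of_nonneg hx]
  set V := ∫ x, g x ^ 2 ∂μ
  have hV0 : 0 ≤ V := integral_nonneg fun x => sq_nonneg _
  -- For `0 < ε ≤ 1` both exponents below have absolute value at most `ε * A`, so one constant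
  -- controls every cubic remainder.
  set A := B + M
  have hA0 : 0 ≤ A := by positivity
  -- the two expansions
  have hQ : ∀ ε, 0 < ε → ε * A ≤ 1 →
      1 + ε ^ 2 * V / 2 - ε ^ 3 * A ^ 3 ≤ ∫ x, Real.exp (-(ε * g x)) ∂μ := by
    intro ε hε hεA
    have hI : Integrable (fun x => 1 + (-ε) * g x + ε ^ 2 / 2 * g x ^ 2 - ε ^ 3 * A ^ 3) μ :=
      (((integrable_const _).add (hgi.const_mul _)).add (hg2.const_mul _)).sub (integrable_const _)
    have hle : ∫ x, (1 + (-ε) * g x + ε ^ 2 / 2 * g x ^ 2 - ε ^ 3 * A ^ 3) ∂μ ≤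
        ∫ x, Real.exp (-(ε * g x)) ∂μ := by
      refine integral_mono_ae hI (Integrable.of_bound
        (Real.continuous_exp.comp_aestronglyMeasurable (hgm.const_mul ε).neg) (Real.exp 1) ?_) ?_
      · filter_upwards [hfB] with x hx
        rw [Real.norm_eq_abs, Real.abs_exp, Real.exp_le_exp]
        have := (abs_le.1 hx).1
        change -B ≤ g x at this
        nlinarith
      · filter_upwards [hfB] with x hx
        change |g x| ≤ B at hx
        have h1 : |-(ε * g x)| ≤ ε * A := by
          rw [abs_neg, abs_mul, abs_of_pos hε]
          have : |g x| ≤ A := hx.trans (by linarith)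
          gcongr
        have h2 := one_add_add_sub_le_exp (h1.trans hεA)
        have h3 : |-(ε * g x)| ^ 3 ≤ (ε * A) ^ 3 := by gcongr
        have h4 : (ε * A) ^ 3 = ε ^ 3 * A ^ 3 := by ring
        have h5 : (-(ε * g x)) ^ 2 / 2 = ε ^ 2 / 2 * g x ^ 2 := by ring
        linarith
    have e1 : ∫ x, (1 + (-ε) * g x + ε ^ 2 / 2 * g x ^ 2 - ε ^ 3 * A ^ 3) ∂μ =
        1 + ε ^ 2 * V / 2 - ε ^ 3 * A ^ 3 := by
      have i1 : Integrable (fun x => 1 + (-ε) * g x) μ := (integrable_const _).add (hgi.const_mul _)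
      have i2 : Integrable (fun x => ε ^ 2 / 2 * g x ^ 2) μ := hg2.const_mul _
      have i3 : Integrable (fun x => 1 + (-ε) * g x + ε ^ 2 / 2 * g x ^ 2) μ := i1.add i2
      rw [integral_sub i3 (integrable_const _), integral_add i1 i2,
        integral_add (integrable_const _) (hgi.const_mul _),
        integral_const_mul, integral_const_mul, hg0]
      simp only [integral_const, probReal_univ, smul_eq_mul]
      change _ + ε ^ 2 / 2 * V - _ = _
      ring
    linarith
  have hP : ∀ ε, 0 < ε → ε ≤ 1 → ε * A ≤ 1 →
      1 + ε ^ 2 * (V / 2 - ∫ x, m ε x ∂μ) - ε ^ 3 * (A ^ 3 + A ^ 2) ≤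
        ∫ x, Real.exp (ε * g x - ε ^ 2 * m ε x) ∂μ := by
    intro ε hε hε1 hεA
    have hmε := hmi ε hε
    have hI : Integrable (fun x => 1 + ε * g x + ε ^ 2 / 2 * g x ^ 2 - ε ^ 2 * m ε x
        - ε ^ 3 * (A ^ 3 + A ^ 2)) μ :=
      ((((integrable_const _).add (hgi.const_mul _)).add (hg2.const_mul _)).sub
        (hmε.const_mul _)).sub (integrable_const _)
    have hle : ∫ x, (1 + ε * g x + ε ^ 2 / 2 * g x ^ 2 - ε ^ 2 * m ε x
        - ε ^ 3 * (A ^ 3 + A ^ 2)) ∂μ ≤ ∫ x, Real.exp (ε * g x - ε ^ 2 * m ε x) ∂μ := by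
      refine integral_mono_ae hI (Integrable.of_bound
        (Real.continuous_exp.comp_aestronglyMeasurable
          ((hgm.const_mul ε).sub ((hm ε).const_mul _))) (Real.exp 1) ?_) ?_
      · filter_upwards [hfB, hm0 ε hε] with x hx hx0
        rw [Real.norm_eq_abs, Real.abs_exp, Real.exp_le_exp]
        have := (abs_le.1 hx).2
        change g x ≤ B at this
        have h1 : ε * g x ≤ ε * A := by gcongr; linarith
        have h2 : 0 ≤ ε ^ 2 * m ε x := by positivity
        linarith
      · filter_upwards [hfB, hm0 ε hε, hmM ε hε] with x hx hx0 hxM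
        change |g x| ≤ B at hx
        have h0 : ε ^ 2 * m ε x ≤ ε * M := by
          rw [pow_two, mul_assoc]
          have : ε * m ε x ≤ 1 * M := by gcongr
          nlinarith
        have h1 : |ε * g x - ε ^ 2 * m ε x| ≤ ε * A := by
          refine (abs_sub _ _).trans ?_
          rw [abs_mul, abs_of_pos hε, abs_of_nonneg (by positivity : 0 ≤ ε ^ 2 * m ε x)]
          have : ε * |g x| ≤ ε * B := by gcongr
          simp only [A]; linarith
        have h2 := one_add_add_sub_le_exp (h1.trans hεA)
        have h3 : |ε * g x - ε ^ 2 * m ε x| ^ 3 ≤ (ε * A) ^ 3 := by gcongr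
        have h4 : (ε * A) ^ 3 = ε ^ 3 * A ^ 3 := by ring
        have h5 : g x * m ε x ≤ A ^ 2 := by
          calc g x * m ε x ≤ B * M := by
                have := (abs_le.1 hx).2
                gcongr
            _ ≤ A ^ 2 := by simp only [A]; nlinarith
        have h6 : (ε * g x - ε ^ 2 * m ε x) ^ 2 / 2 = ε ^ 2 / 2 * g x ^ 2 - ε ^ 3 * (g x * m ε x)
            + (ε ^ 2 * m ε x) ^ 2 / 2 := by ring
        have h7 : ε ^ 3 * (g x * m ε x) ≤ ε ^ 3 * A ^ 2 := by gcongr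
        have h8 : 0 ≤ (ε ^ 2 * m ε x) ^ 2 / 2 := by positivity
        linarith
    have e1 : ∫ x, (1 + ε * g x + ε ^ 2 / 2 * g x ^ 2 - ε ^ 2 * m ε x
        - ε ^ 3 * (A ^ 3 + A ^ 2)) ∂μ =
        1 + ε ^ 2 * (V / 2 - ∫ x, m ε x ∂μ) - ε ^ 3 * (A ^ 3 + A ^ 2) := by
      have i1 : Integrable (fun x => 1 + ε * g x) μ := (integrable_const _).add (hgi.const_mul _)
      have i2 : Integrable (fun x => ε ^ 2 / 2 * g x ^ 2) μ := hg2.const_mul _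
      have i3 : Integrable (fun x => 1 + ε * g x + ε ^ 2 / 2 * g x ^ 2) μ := i1.add i2
      have i4 : Integrable (fun x => ε ^ 2 * m ε x) μ := hmε.const_mul _
      have i5 : Integrable (fun x => 1 + ε * g x + ε ^ 2 / 2 * g x ^ 2 - ε ^ 2 * m ε x) μ :=
        i3.sub i4
      rw [integral_sub i5 (integrable_const _), integral_sub i3 i4, integral_add i1 i2,
        integral_add (integrable_const _) (hgi.const_mul _),
        integral_const_mul, integral_const_mul, integral_const_mul, hg0]
      simp only [integral_const, probReal_univ, smul_eq_mul]
      change _ + ε ^ 2 / 2 * V - _ - _ = _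
      ring
    linarith
  have hPQ : ∀ ε > 0, (∫ x, Real.exp (ε * g x - ε ^ 2 * m ε x) ∂μ) *
      ∫ x, Real.exp (-(ε * g x)) ∂μ ≤ 1 := by
    intro ε hε
    have e1 : ∀ x, Real.exp (ε * g x - ε ^ 2 * m ε x) =
        Real.exp (-(ε * c)) * Real.exp (ε * f x - ε ^ 2 * m ε x) := fun x => by
      rw [← Real.exp_add]; congr 1; simp only [g]; ring
    have e2 : ∀ x, Real.exp (-(ε * g x)) = Real.exp (ε * c) * Real.exp (-(ε * f x)) := fun x => by
      rw [← Real.exp_add]; congr 1; simp only [g]; ring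
    simp_rw [e1, e2, integral_const_mul]
    have e3 : Real.exp (-(ε * c)) * Real.exp (ε * c) = 1 := by rw [← Real.exp_add]; simp
    calc _ = (Real.exp (-(ε * c)) * Real.exp (ε * c)) *
          ((∫ x, Real.exp (ε * f x - ε ^ 2 * m ε x) ∂μ) * ∫ x, Real.exp (-(ε * f x)) ∂μ) := by ring
      _ ≤ 1 := by rw [e3, one_mul]; exact h ε hε
  have hD : Tendsto (fun ε => ∫ x, m ε x ∂μ) (𝓝[>] 0) (𝓝 (∫ x, m₀ x ∂μ)) := by
    refine tendsto_integral_filter_of_dominated_convergence (fun _ => M)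
      (Eventually.of_forall hm) ?_ (integrable_const _) hlim
    filter_upwards [self_mem_nhdsWithin] with ε (hε : 0 < ε)
    filter_upwards [hm0 ε hε, hmM ε hε] with x hx hx'
    rwa [Real.norm_eq_abs, abs_of_nonneg hx]
  have hDM : ∀ ε > 0, ∫ x, m ε x ∂μ ≤ M := fun ε hε => by
    have := integral_mono_ae (hmi ε hε) (integrable_const M) (hmM ε hε)
    simpa using this
  set c₁ := A ^ 3 + A ^ 2
  have hc₁ : 0 ≤ c₁ := by positivity
  -- the error term
  let R : ℝ → ℝ := fun ε => 2 * c₁ * ε + ε ^ 2 * (M + c₁ * ε) * V / 2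
    + ε ^ 3 * (V / 2 + M + c₁ * ε) * c₁
  have hR : Tendsto R (𝓝[>] 0) (𝓝 0) := by
    have : Tendsto R (𝓝 0) (𝓝 (R 0)) := Continuous.tendsto (by fun_prop) 0
    have h0 : R 0 = 0 := by simp [R]
    rw [h0] at this
    exact this.mono_left nhdsWithin_le_nhds
  -- These conditions justify both expansions and make their lower bounds nonnegative, so that the
  -- two bounds can be multiplied.
  have hsmall : ∀ᶠ ε in 𝓝[>] (0 : ℝ), ε ≤ 1 ∧ ε * A ≤ 1 ∧ ε ^ 3 * c₁ ≤ 1 / 2 ∧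
      ε ^ 2 * M ≤ 1 / 2 := by
    have hc : ∀ φ : ℝ → ℝ, Continuous φ → φ 0 = 0 → ∀ b > 0, ∀ᶠ ε in 𝓝[>] (0 : ℝ), φ ε ≤ b := by
      intro φ hφ h0 b hb
      have : Tendsto φ (𝓝 0) (𝓝 0) := by simpa [h0] using hφ.tendsto 0
      exact (this.mono_left nhdsWithin_le_nhds).eventually (eventually_le_nhds hb)
    filter_upwards [hc id continuous_id rfl 1 one_pos,
      hc (fun ε => ε * A) (by fun_prop) (by simp) 1 one_pos,
      hc (fun ε => ε ^ 3 * c₁) (by fun_prop) (by simp) (1 / 2) (by norm_num),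
      hc (fun ε => ε ^ 2 * M) (by fun_prop) (by simp) (1 / 2) (by norm_num)] with ε h1 h2 h3 h4
    exact ⟨h1, h2, h3, h4⟩
  refine ge_of_tendsto (by simpa using hD.add hR) ?_
  filter_upwards [self_mem_nhdsWithin, hsmall] with ε (hε : 0 < ε) hsm
  obtain ⟨h1, h2, h3, h4⟩ := hsm
  have p := hP ε hε h1 h2
  have q := hQ ε hε h2
  have pq := hPQ ε hε
  have hDε := hDM ε hε
  have hD0 : 0 ≤ ∫ x, m ε x ∂μ := integral_nonneg_of_ae (hm0 ε hε)
  set D := ∫ x, m ε x ∂μ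
  have q' : 1 + ε ^ 2 * V / 2 - ε ^ 3 * c₁ ≤ ∫ x, Real.exp (-(ε * g x)) ∂μ := by
    refine le_trans ?_ q
    have : ε ^ 3 * A ^ 3 ≤ ε ^ 3 * c₁ := by
      gcongr; simp only [c₁]; nlinarith
    linarith
  have p0 : 0 ≤ 1 + ε ^ 2 * (V / 2 - D) - ε ^ 3 * c₁ := by
    have : ε ^ 2 * D ≤ ε ^ 2 * M := by gcongr
    nlinarith [mul_nonneg (sq_nonneg ε) hV0]
  have q0 : 0 ≤ 1 + ε ^ 2 * V / 2 - ε ^ 3 * c₁ := by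
    nlinarith [mul_nonneg (sq_nonneg ε) hV0]
  have hprod := (mul_le_mul p q' q0 (p0.trans p)).trans pq
  -- `hprod` is `(1 + ε²(V/2 - D) - ε³c₁)(1 + ε²V/2 - ε³c₁) ≤ 1`
  have hexp : (1 + ε ^ 2 * (V / 2 - D) - ε ^ 3 * c₁) * (1 + ε ^ 2 * V / 2 - ε ^ 3 * c₁) =
      1 + ε ^ 2 * ((V - D) - 2 * c₁ * ε + ε ^ 2 * (V / 2 - D - c₁ * ε) * V / 2
        - ε ^ 3 * (V / 2 - D - c₁ * ε) * c₁) := by ring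
  rw [hexp] at hprod
  have hε2 : 0 < ε ^ 2 := by positivity
  have hle : (V - D) - 2 * c₁ * ε + ε ^ 2 * (V / 2 - D - c₁ * ε) * V / 2
        - ε ^ 3 * (V / 2 - D - c₁ * ε) * c₁ ≤ 0 := by
    by_contra hcon
    push Not at hcon
    nlinarith [mul_pos hε2 hcon]
  have hb1 : ε ^ 2 * (-(M + c₁ * ε)) * V / 2 ≤ ε ^ 2 * (V / 2 - D - c₁ * ε) * V / 2 := by
    gcongr; linarith
  have hb2 : ε ^ 3 * (V / 2 - D - c₁ * ε) * c₁ ≤ ε ^ 3 * (V / 2 + M + c₁ * ε) * c₁ := by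
    have : 0 ≤ c₁ * ε := by positivity
    gcongr ?_ * ?_ * _
    linarith
  simp only [R]
  linarith

end Poincare

end BPX

namespace BPX

/-! ### Dimension-free Poincaré inequality on convex sets -/

section Poincare

open Filter Topology
open scoped NNReal ENNReal

variable {d : ℕ}

/-- The rescaled defect of the infimum convolution of `ε f` with `‖·‖² / (4 h²)`. -/
noncomputable def convDefect (f : E d → ℝ) (h ε : ℝ) (x : E d) : ℝ :=
  ⨆ y, ((f x - f y) / ε - ‖x - y‖ ^ 2 / (4 * h ^ 2 * ε ^ 2))

variable {f : E d → ℝ} {L : ℝ≥0} {h : ℝ}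

/-- With `t = ‖x - y‖ / ε` the term is at most `L t - t² / (4h²)`, whose maximum is `h² L²`. The
bound is uniform in `ε`, as dominated convergence requires. -/
theorem convDefect_term_le (hf : LipschitzWith L f) (hh : 0 < h) {ε : ℝ} (hε : 0 < ε) (x y : E d) :
    (f x - f y) / ε - ‖x - y‖ ^ 2 / (4 * h ^ 2 * ε ^ 2) ≤ h ^ 2 * L ^ 2 := by
  have h1 : f x - f y ≤ L * ‖x - y‖ := by
    have := hf.dist_le_mul x y
    rw [Real.dist_eq, dist_eq_norm] at this
    exact (le_abs_self _).trans this
  have h2 : (f x - f y) / ε ≤ L * (‖x - y‖ / ε) := by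
    rw [← mul_div_assoc]; gcongr
  have h3 : ‖x - y‖ ^ 2 / (4 * h ^ 2 * ε ^ 2) = (‖x - y‖ / ε / (2 * h)) ^ 2 := by
    field_simp; ring
  rw [h3]
  have h4 : L * (‖x - y‖ / ε) = 2 * (h * L) * (‖x - y‖ / ε / (2 * h)) := by field_simp
  nlinarith [sq_nonneg (h * L - ‖x - y‖ / ε / (2 * h))]

theorem bddAbove_convDefect (hf : LipschitzWith L f) (hh : 0 < h) {ε : ℝ} (hε : 0 < ε) (x : E d) :
    BddAbove (range fun y => (f x - f y) / ε - ‖x - y‖ ^ 2 / (4 * h ^ 2 * ε ^ 2)) :=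
  ⟨h ^ 2 * L ^ 2, by rintro _ ⟨y, rfl⟩; exact convDefect_term_le hf hh hε x y⟩

theorem convDefect_nonneg (hf : LipschitzWith L f) (hh : 0 < h) {ε : ℝ} (hε : 0 < ε) (x : E d) :
    0 ≤ convDefect f h ε x := by
  refine le_trans (by simp) (le_ciSup (bddAbove_convDefect hf hh hε x) x)

theorem convDefect_le (hf : LipschitzWith L f) (hh : 0 < h) {ε : ℝ} (hε : 0 < ε) (x : E d) :
    convDefect f h ε x ≤ h ^ 2 * L ^ 2 :=
  ciSup_le fun y => convDefect_term_le hf hh hε x y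

/-- The supremum runs over an uncountable family, so measurability is obtained from lower
semicontinuity. -/
theorem measurable_convDefect (hf : LipschitzWith L f) (hh : 0 < h) {ε : ℝ} (hε : 0 < ε) :
    Measurable (convDefect f h ε) := by
  have hc := hf.continuous
  refine (lowerSemicontinuous_ciSup (bddAbove_convDefect hf hh hε) fun y => ?_).measurable
  exact Continuous.lowerSemicontinuous (by fun_prop)

/-- The left side is the infimum convolution of `ε f` with `‖·‖² / (4h²)`; this bound supplies the
pointwise hypothesis of Prékopa–Leindler. -/
theorem sub_mul_convDefect_le (hf : LipschitzWith L f) (hh : 0 < h) {ε : ℝ} (hε : 0 < ε)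
    (x y : E d) :
    ε * f x - ε ^ 2 * convDefect f h ε x ≤ ε * f y + ‖x - y‖ ^ 2 / (4 * h ^ 2) := by
  have h1 := le_ciSup (bddAbove_convDefect hf hh hε x) y
  have h2 : ε ^ 2 * ((f x - f y) / ε - ‖x - y‖ ^ 2 / (4 * h ^ 2 * ε ^ 2)) =
      ε * f x - ε * f y - ‖x - y‖ ^ 2 / (4 * h ^ 2) := by
    field_simp
  have h3 := mul_le_mul_of_nonneg_left h1 (sq_nonneg ε)
  rw [h2] at h3
  change _ ≤ ε ^ 2 * convDefect f h ε x at h3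
  linarith

/-- At scale `ε` the function is nearly linear, and the supremum approaches that of `‖g‖ t - t² /
(4h²)` over `t ≥ 0`, namely `h² ‖g‖²`. -/
theorem tendsto_convDefect (hf : LipschitzWith L f) (hh : 0 < h) {x : E d}
    (hx : DifferentiableAt ℝ f x) :
    Tendsto (fun ε => convDefect f h ε x) (𝓝[>] 0) (𝓝 (h ^ 2 * ‖gradient f x‖ ^ 2)) := by
  set g := gradient f x
  have hgr : HasGradientAt f g x := hx.hasGradientAt
  have hlin : ∀ η > 0, ∃ r > 0, ∀ y, ‖y - x‖ ≤ r →
      |f y - f x - inner ℝ g (y - x)| ≤ η * ‖y - x‖ := by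
    intro η hη
    have := (hasGradientAt_iff_isLittleO.1 hgr).def hη
    obtain ⟨r, hr, hr'⟩ := Metric.eventually_nhds_iff_ball.1 this
    refine ⟨r / 2, by positivity, fun y hy => ?_⟩
    have := hr' y (by rw [Metric.mem_ball, dist_eq_norm]; linarith)
    simpa using this
  -- upper bound
  have hup : ∀ η > 0, ∀ᶠ ε in 𝓝[>] (0 : ℝ), convDefect f h ε x ≤ h ^ 2 * (‖g‖ + η) ^ 2 := by
    intro η hη
    obtain ⟨r, hr, hlr⟩ := hlin η hη
    have hsm : ∀ᶠ ε in 𝓝[>] (0 : ℝ), ε * (4 * h ^ 2 * L) ≤ r := by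
      have : Tendsto (fun ε : ℝ => ε * (4 * h ^ 2 * L)) (𝓝 0) (𝓝 0) := by
        have := (continuous_mul_const (4 * h ^ 2 * (L : ℝ))).tendsto (0 : ℝ)
        rwa [zero_mul] at this
      exact (this.mono_left nhdsWithin_le_nhds).eventually (eventually_le_nhds hr)
    filter_upwards [self_mem_nhdsWithin, hsm] with ε (hε : 0 < ε) hεr
    refine ciSup_le fun y => ?_
    set t := ‖x - y‖ / ε
    have ht0 : 0 ≤ t := by positivity
    have h3 : ‖x - y‖ ^ 2 / (4 * h ^ 2 * ε ^ 2) = (t / (2 * h)) ^ 2 := by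
      simp only [t]; field_simp; ring
    rw [h3]
    rcases le_or_gt ‖y - x‖ r with hy | hy
    · have h1 := (abs_le.1 (hlr y hy)).1
      have h2 : -(inner ℝ g (y - x)) ≤ ‖g‖ * ‖y - x‖ :=
        (neg_le_abs _).trans (abs_real_inner_le_norm _ _)
      have h4 : (f x - f y) / ε ≤ (‖g‖ + η) * t := by
        rw [div_le_iff₀ hε]
        have : (‖g‖ + η) * t * ε = (‖g‖ + η) * ‖y - x‖ := by
          simp only [t]; rw [norm_sub_rev]; field_simp
        rw [this]; linarith
      have h5 : (‖g‖ + η) * t = 2 * (h * (‖g‖ + η)) * (t / (2 * h)) := by field_simp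
      nlinarith [sq_nonneg (h * (‖g‖ + η) - t / (2 * h))]
    -- For distant `y` differentiability says nothing, but there the quadratic penalty outweighs the
    -- Lipschitz gain and the term is nonpositive.
    · have h1 : f x - f y ≤ L * ‖x - y‖ := by
        have := hf.dist_le_mul x y
        rw [Real.dist_eq, dist_eq_norm] at this
        exact (le_abs_self _).trans this
      have h4 : (f x - f y) / ε ≤ L * t := by
        simp only [t]; rw [← mul_div_assoc]; gcongr
      have h5 : 4 * h ^ 2 * L ≤ t := by
        simp only [t]
        rw [le_div_iff₀ hε, norm_sub_rev, mul_comm]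
        linarith
      have h6 : L * t ≤ (t / (2 * h)) ^ 2 := by
        rw [div_pow, le_div_iff₀ (by positivity)]
        nlinarith
      have : 0 ≤ h ^ 2 * (‖g‖ + η) ^ 2 := by positivity
      linarith
  have hlow : ∀ η > 0, ∀ᶠ ε in 𝓝[>] (0 : ℝ),
      h ^ 2 * ‖g‖ ^ 2 - η * (2 * h ^ 2 * ‖g‖) ≤ convDefect f h ε x := by
    intro η hη
    obtain ⟨r, hr, hlr⟩ := hlin η hη
    have hsm : ∀ᶠ ε in 𝓝[>] (0 : ℝ), ε * (2 * h ^ 2 * ‖g‖) ≤ r := by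
      have : Tendsto (fun ε : ℝ => ε * (2 * h ^ 2 * ‖g‖)) (𝓝 0) (𝓝 0) := by
        have := (continuous_mul_const (2 * h ^ 2 * ‖g‖)).tendsto (0 : ℝ)
        rwa [zero_mul] at this
      exact (this.mono_left nhdsWithin_le_nhds).eventually (eventually_le_nhds hr)
    filter_upwards [self_mem_nhdsWithin, hsm] with ε (hε : 0 < ε) hεr
    -- This is the exact maximiser for the linearised function.
    have hb := le_ciSup (bddAbove_convDefect hf hh hε x) (x - (2 * h ^ 2 * ε) • g)
    refine le_trans ?_ hb
    have e1 : x - (2 * h ^ 2 * ε) • g - x = -((2 * h ^ 2 * ε) • g) := by abel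
    have n1 : ‖(2 * h ^ 2 * ε) • g‖ = 2 * h ^ 2 * ε * ‖g‖ := by
      rw [norm_smul, Real.norm_eq_abs, abs_of_pos (by positivity)]
    have h1 := hlr (x - (2 * h ^ 2 * ε) • g) (by rw [e1, norm_neg, n1]; linarith)
    rw [e1, norm_neg, n1, inner_neg_right, real_inner_smul_right,
      real_inner_self_eq_norm_sq] at h1
    have h2 := (abs_le.1 h1).2
    rw [sub_sub_cancel, n1]
    have h4 : (2 * h ^ 2 * ε * ‖g‖) ^ 2 / (4 * h ^ 2 * ε ^ 2) = h ^ 2 * ‖g‖ ^ 2 := by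
      field_simp; ring
    rw [h4]
    have h5 : 2 * h ^ 2 * ‖g‖ ^ 2 - η * (2 * h ^ 2 * ‖g‖) ≤
        (f x - f (x - (2 * h ^ 2 * ε) • g)) / ε := by
      rw [le_div_iff₀ hε]; nlinarith
    linarith
  rw [tendsto_order]
  constructor
  · intro b hb
    have hcont : Tendsto (fun η : ℝ => h ^ 2 * ‖g‖ ^ 2 - η * (2 * h ^ 2 * ‖g‖)) (𝓝[>] 0)
        (𝓝 (h ^ 2 * ‖g‖ ^ 2)) := by
      have : Tendsto (fun η : ℝ => h ^ 2 * ‖g‖ ^ 2 - η * (2 * h ^ 2 * ‖g‖)) (𝓝 0)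
        (𝓝 (h ^ 2 * ‖g‖ ^ 2 - 0 * (2 * h ^ 2 * ‖g‖))) := Continuous.tendsto (by fun_prop) 0
      simp only [zero_mul, sub_zero] at this
      exact this.mono_left nhdsWithin_le_nhds
    obtain ⟨η, hη, hη'⟩ := ((hcont.eventually (lt_mem_nhds hb)).and self_mem_nhdsWithin).exists
    filter_upwards [hlow η hη'] with ε hε
    linarith
  · intro b hb
    have hcont : Tendsto (fun η : ℝ => h ^ 2 * (‖g‖ + η) ^ 2) (𝓝[>] 0)
        (𝓝 (h ^ 2 * ‖g‖ ^ 2)) := by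
      have : Tendsto (fun η : ℝ => h ^ 2 * (‖g‖ + η) ^ 2) (𝓝 0)
        (𝓝 (h ^ 2 * (‖g‖ + 0) ^ 2)) := Continuous.tendsto (by fun_prop) 0
      simp only [add_zero] at this
      exact this.mono_left nhdsWithin_le_nhds
    obtain ⟨η, hη, hη'⟩ := ((hcont.eventually (gt_mem_nhds hb)).and self_mem_nhdsWithin).exists
    filter_upwards [hup η hη'] with ε hε
    linarith

theorem norm_gradient_le (hf : LipschitzWith L f) (x : E d) : ‖gradient f x‖ ≤ L := by
  rw [gradient, LinearIsometryEquiv.norm_map]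
  exact norm_fderiv_le_of_lipschitz ℝ hf

theorem measurable_gradient (f : E d → ℝ) : Measurable (gradient f) :=
  (InnerProductSpace.toDual ℝ (E d)).symm.continuous.measurable.comp (measurable_fderiv ℝ f)

theorem integrableOn_of_norm_le {F : Type*} [NormedAddCommGroup F] {s : Set (E d)}
    {g : E d → F} (hs : Bornology.IsBounded s) (hg : AEStronglyMeasurable g (volume.restrict s))
    {C : ℝ} (hC : ∀ᵐ x ∂volume.restrict s, ‖g x‖ ≤ C) : IntegrableOn g s := by
  have : IsFiniteMeasure (volume.restrict s) := ⟨by simpa using hs.measure_lt_top⟩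
  exact Integrable.of_bound hg C hC

theorem integrableOn_norm_gradient_sq (hf : LipschitzWith L f) {s : Set (E d)}
    (hs : Bornology.IsBounded s) : IntegrableOn (fun x => ‖gradient f x‖ ^ 2) s := by
  refine integrableOn_of_norm_le hs ((measurable_gradient f).norm.pow_const 2).aestronglyMeasurable
    (C := L ^ 2) (ae_of_all _ fun x => ?_)
  rw [Real.norm_eq_abs, abs_pow, abs_norm]
  gcongr
  exact norm_gradient_le hf x

theorem integrableOn_of_continuous {g : E d → ℝ} (hg : Continuous g) {s : Set (E d)}
    (hs : Bornology.IsBounded s) : IntegrableOn g s :=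
  (hg.continuousOn.integrableOn_compact hs.isCompact_closure).mono_set subset_closure

/-- The Poincaré inequality on a bounded convex set, with a constant independent of the dimension. -/
theorem exists_integral_sub_sq_le_of_convex (hf : LipschitzWith L f) {K : Set (E d)}
    (hK : Convex ℝ K) (hKm : MeasurableSet K) {a : E d} (hh : 0 < h)
    (hKa : K ⊆ Metric.closedBall a h) :
    ∃ c, ∫ x in K, (f x - c) ^ 2 ≤ 2 * h ^ 2 * ∫ x in K, ‖gradient f x‖ ^ 2 := by
  have hKb : Bornology.IsBounded K := Metric.isBounded_closedBall.subset hKa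
  rcases eq_or_ne (volume K) 0 with hK0 | hK0
  · exact ⟨0, by simp [Measure.restrict_eq_zero.2 hK0]⟩
  -- A Gaussian at the scale of the enclosing ball: uniformly log-concave, yet between `1/2` and `1`
  -- on `K`, so removing it later costs only a factor 2.
  let γ : E d → ℝ≥0 := fun x => Real.toNNReal (Real.exp (-(‖x - a‖ ^ 2 / (2 * h ^ 2))))
  have hγ : ∀ x, (γ x : ℝ) = Real.exp (-(‖x - a‖ ^ 2 / (2 * h ^ 2))) := fun x =>
    Real.coe_toNNReal _ (Real.exp_pos _).le
  have hγm : Measurable γ := by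
    refine Measurable.real_toNNReal (Continuous.measurable ?_)
    fun_prop
  have hγ1 : ∀ x, (γ x : ℝ) ≤ 1 := fun x => by
    rw [hγ, Real.exp_le_one_iff, neg_nonpos]; positivity
  have hγ2 : ∀ x ∈ K, (1 : ℝ) ≤ 2 * γ x := fun x hx => by
    have h1 : ‖x - a‖ ≤ h := by simpa [dist_eq_norm] using hKa hx
    have h2 : ‖x - a‖ ^ 2 / (2 * h ^ 2) ≤ 1 / 2 := by
      rw [div_le_iff₀ (by positivity)]
      have : ‖x - a‖ ^ 2 ≤ h ^ 2 := by gcongr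
      linarith
    rw [hγ]
    have h3 : Real.exp (-(1 / 2)) ≤ Real.exp (-(‖x - a‖ ^ 2 / (2 * h ^ 2))) := by
      rw [Real.exp_le_exp]; linarith
    have h4 := Real.add_one_le_exp (-(1 / 2 : ℝ))
    linarith
  let ν : Measure (E d) := (volume.restrict K).withDensity fun x => (γ x : ℝ≥0∞)
  have hνint : ∀ g : E d → ℝ, ∫ x, g x ∂ν = ∫ x in K, γ x * g x := fun g =>
    integral_withDensity_eq_integral_smul hγm g
  have hνuniv : ν univ = ∫⁻ x in K, γ x := by
    simp [ν, withDensity_apply]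
  have hνtop : ν univ ≠ ∞ := by
    rw [hνuniv]
    refine ne_top_of_le_ne_top (hKb.measure_lt_top (μ := volume)).ne ?_
    refine (lintegral_mono (g := fun _ => 1) fun x => ?_).trans (by simp)
    exact ENNReal.coe_le_one_iff.2 (by exact_mod_cast hγ1 x)
  have hν0 : ν univ ≠ 0 := by
    rw [hνuniv]
    intro h0
    rw [lintegral_eq_zero_iff (by fun_prop)] at h0
    have : ∀ᵐ x ∂volume.restrict K, False := by
      filter_upwards [h0, ae_restrict_mem hKm] with x hx hxK
      have := hγ2 x hxK
      simp only [Pi.zero_apply, ENNReal.coe_eq_zero] at hx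
      rw [hx] at this
      norm_num at this
    rw [ae_iff] at this
    simp at this
    exact hK0 this
  have : IsFiniteMeasure ν := ⟨hνtop.lt_top⟩
  let μ : Measure (E d) := (ν univ)⁻¹ • ν
  have hμ : IsProbabilityMeasure μ :=
    ⟨by simp [μ, ENNReal.inv_mul_cancel hν0 hνtop]⟩
  set Z : ℝ := (ν univ).toReal
  have hZ : 0 < Z := ENNReal.toReal_pos hν0 hνtop
  have hμint : ∀ g : E d → ℝ, ∫ x, g x ∂μ = Z⁻¹ * ∫ x in K, γ x * g x := fun g => by
    rw [integral_smul_measure, hνint, ENNReal.toReal_inv, smul_eq_mul]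
  have haeK : ∀ᵐ x ∂μ, x ∈ K := by
    refine Measure.ae_smul_measure ?_ _
    exact (withDensity_absolutelyContinuous _ _).ae_le (ae_restrict_mem hKm)
  have haevol : ∀ p : E d → Prop, (∀ᵐ x, p x) → ∀ᵐ x ∂μ, p x := fun p hp => by
    refine Measure.ae_smul_measure ?_ _
    exact (withDensity_absolutelyContinuous _ _).ae_le (ae_restrict_of_ae hp)
  obtain ⟨B, hB⟩ : ∃ B, ∀ x ∈ K, |f x - ∫ y, f y ∂μ| ≤ B := by
    obtain ⟨B, hB⟩ := hKb.isCompact_closure.exists_bound_of_continuousOn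
      (hf.continuous.sub (continuous_const (y := ∫ y, f y ∂μ))).continuousOn
    exact ⟨B, fun x hx => hB x (subset_closure hx)⟩
  have hvar : ∫ x, (f x - ∫ y, f y ∂μ) ^ 2 ∂μ ≤ ∫ x, h ^ 2 * ‖gradient f x‖ ^ 2 ∂μ := by
    refine integral_sub_sq_le_of_exp (B := B) (M := h ^ 2 * L ^ 2)
      -- The value 0 for `ε ≤ 0` serves only to have measurability for every `ε`.
      (m := fun ε x => if 0 < ε then convDefect f h ε x else 0)
      hf.continuous.aestronglyMeasurable
      (by filter_upwards [haeK] with x hx using hB x hx)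
      (fun ε => ?_) (fun ε hε => ae_of_all _ fun x => ?_) (fun ε hε => ae_of_all _ fun x => ?_)
      ?_ (fun ε hε => ?_)
    · by_cases hε : 0 < ε
      · simpa [hε] using (measurable_convDefect hf hh hε).aestronglyMeasurable
      · simpa [hε] using aestronglyMeasurable_const
    · simpa [show 0 < ε from hε] using convDefect_nonneg hf hh hε x
    · simpa [show 0 < ε from hε] using convDefect_le hf hh hε x
    · refine haevol _ ?_
      filter_upwards [hf.ae_differentiableAt] with x hx
      refine (tendsto_convDefect hf hh hx).congr' ?_
      filter_upwards [self_mem_nhdsWithin] with ε (hε : 0 < ε)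
      simp [hε]
    · replace hε : 0 < ε := hε
      simp only [hε, if_true]
      have hmeas := measurable_convDefect hf hh hε
      have hfm := hf.continuous.measurable
      let u : E d → ℝ≥0∞ := K.indicator fun x => ENNReal.ofReal
        (γ x * Real.exp (ε * f x - ε ^ 2 * convDefect f h ε x))
      let v : E d → ℝ≥0∞ := K.indicator fun x => ENNReal.ofReal (γ x * Real.exp (-(ε * f x)))
      let w : E d → ℝ≥0∞ := K.indicator fun x => (γ x : ℝ≥0∞)
      have hPL : (∫⁻ x, u x) * ∫⁻ x, v x ≤ (∫⁻ x, w x) ^ 2 := by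
        refine prekopaLeindler (Measurable.indicator (by fun_prop) hKm)
          (Measurable.indicator (by fun_prop) hKm) (Measurable.indicator (by fun_prop) hKm)
          fun x y => ?_
        by_cases hx : x ∈ K
        swap
        · simp [u, hx]
        by_cases hy : y ∈ K
        swap
        · simp [v, hy]
        have hxy : (2 : ℝ)⁻¹ • (x + y) ∈ K := by
          rw [smul_add]
          exact hK hx hy (by norm_num) (by norm_num) (by norm_num)
        simp only [u, v, w, indicator_of_mem hx, indicator_of_mem hy, indicator_of_mem hxy]
        rw [← ENNReal.ofReal_mul (by positivity), ← ENNReal.ofReal_coe_nnreal,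
          ← ENNReal.ofReal_pow (by positivity)]
        refine ENNReal.ofReal_le_ofReal ?_
        simp only [hγ]
        rw [← Real.exp_add, ← Real.exp_add, ← Real.exp_add, ← Real.exp_nat_mul, Real.exp_le_exp]
        -- The parallelogram law shows that the Gaussian has a midpoint surplus of exactly `‖x - y‖²
        -- / (4h²)` in the exponent, which pays for the infimum convolution.
        have hpar : ‖x - a‖ ^ 2 + ‖y - a‖ ^ 2 =
            2 * ‖(2 : ℝ)⁻¹ • (x + y) - a‖ ^ 2 + ‖x - y‖ ^ 2 / 2 := by
          have e1 := parallelogram_law_with_norm ℝ (x - a) (y - a)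
          have e2 : x - a + (y - a) = (2 : ℝ) • ((2 : ℝ)⁻¹ • (x + y) - a) := by
            rw [smul_sub, smul_smul]; norm_num; module
          have e3 : x - a - (y - a) = x - y := by abel
          rw [e2, e3, norm_smul, Real.norm_ofNat] at e1
          linarith
        have hs := sub_mul_convDefect_le hf hh hε x y
        have e4 : ‖x - a‖ ^ 2 / (2 * h ^ 2) + ‖y - a‖ ^ 2 / (2 * h ^ 2) =
            2 * (‖(2 : ℝ)⁻¹ • (x + y) - a‖ ^ 2 / (2 * h ^ 2)) + ‖x - y‖ ^ 2 / (4 * h ^ 2) := by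
          rw [← add_div, hpar]; field_simp; ring
        push_cast
        linarith
      have hreal : ∀ g : E d → ℝ, Measurable g → (∫ x, Real.exp (g x) ∂μ) =
          Z⁻¹ * (∫⁻ x, K.indicator (fun x => ENNReal.ofReal (γ x * Real.exp (g x))) x).toReal := by
        intro g hg
        rw [hμint, lintegral_indicator hKm, integral_eq_lintegral_of_nonneg_ae]
        · exact ae_of_all _ fun x => by positivity
        · exact Measurable.aestronglyMeasurable (by fun_prop)
      rw [hreal _ (by fun_prop), hreal _ (by fun_prop)]
      have hw : (∫⁻ x, w x) = ν univ := by rw [hνuniv, ← lintegral_indicator hKm]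
      rw [hw] at hPL
      have := ENNReal.toReal_mono (ENNReal.pow_ne_top hνtop) hPL
      rw [ENNReal.toReal_mul, ENNReal.toReal_pow] at this
      calc _ = (Z⁻¹) ^ 2 * ((∫⁻ x, u x).toReal * (∫⁻ x, v x).toReal) := by
            simp only [u, v]; ring
        _ ≤ (Z⁻¹) ^ 2 * Z ^ 2 := by gcongr
        _ = 1 := by rw [inv_pow, inv_mul_cancel₀ (by positivity)]
  refine ⟨∫ y, f y ∂μ, ?_⟩
  set c := ∫ y, f y ∂μ
  rw [hμint, hμint] at hvar
  have hvar' := le_of_mul_le_mul_left hvar (inv_pos.2 hZ)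
  have hγc : Continuous fun x => (γ x : ℝ) := by
    simp only [hγ]; fun_prop
  have hc := hf.continuous
  have i1 : IntegrableOn (fun x => (f x - c) ^ 2) K :=
    integrableOn_of_continuous (by fun_prop) hKb
  have i2 : IntegrableOn (fun x => 2 * (γ x * (f x - c) ^ 2)) K :=
    integrableOn_of_continuous (by fun_prop) hKb
  have i3 := integrableOn_norm_gradient_sq hf hKb
  have i4 : IntegrableOn (fun x => γ x * (h ^ 2 * ‖gradient f x‖ ^ 2)) K := by
    refine integrableOn_of_norm_le hKb ?_ (C := h ^ 2 * L ^ 2) (ae_of_all _ fun x => ?_)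
    · have := measurable_gradient f
      exact Measurable.aestronglyMeasurable (by fun_prop)
    · rw [Real.norm_eq_abs, abs_of_nonneg (by positivity)]
      have := norm_gradient_le hf x
      calc γ x * (h ^ 2 * ‖gradient f x‖ ^ 2) ≤ 1 * (h ^ 2 * L ^ 2) := by
            gcongr; exact hγ1 x
        _ = _ := one_mul _
  calc ∫ x in K, (f x - c) ^ 2 ≤ ∫ x in K, 2 * (γ x * (f x - c) ^ 2) := by
        refine setIntegral_mono_on i1 i2 hKm fun x hx => ?_
        nlinarith [hγ2 x hx, sq_nonneg (f x - c)]
    _ = 2 * ∫ x in K, γ x * (f x - c) ^ 2 := integral_const_mul _ _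
    _ ≤ 2 * ∫ x in K, γ x * (h ^ 2 * ‖gradient f x‖ ^ 2) := by gcongr
    _ ≤ 2 * ∫ x in K, h ^ 2 * ‖gradient f x‖ ^ 2 := by
        refine mul_le_mul_of_nonneg_left ?_ zero_le_two
        refine setIntegral_mono_on i4 (Integrable.const_mul i3 (h ^ 2)) hKm fun x hx => ?_
        have : 0 ≤ h ^ 2 * ‖gradient f x‖ ^ 2 := by positivity
        nlinarith [hγ1 x]
    _ = _ := by rw [integral_const_mul]; ring

end Poincare

end BPX

namespace BPX

/-! ### Geometry of simplices -/

section CellGeometry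

open Metric

variable {d : ℕ}

/-- The vertices of a simplex as an affine basis. -/
noncomputable def Cell.basis (τ : Cell d) : AffineBasis (Fin (d + 1)) ℝ (E d) :=
  ⟨τ.points, τ.independent,
    τ.independent.affineSpan_eq_top_iff_card_eq_finrank_add_one.2 (by simp)⟩

@[simp] theorem Cell.basis_apply (τ : Cell d) (i : Fin (d + 1)) : Cell.basis τ i = τ.points i := rfl

theorem Cell.convexHull_eq (τ : Cell d) :
    convexHull ℝ (range (Cell.basis τ)) = τ.closedInterior :=
  τ.convexHull_eq_closedInterior

theorem Cell.closedInterior_eq (τ : Cell d) :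
    τ.closedInterior = {x | ∀ i, 0 ≤ (Cell.basis τ).coord i x} := by
  rw [← Cell.convexHull_eq, AffineBasis.convexHull_eq_nonneg_coord]

theorem Cell.interior_closedInterior (τ : Cell d) :
    _root_.interior τ.closedInterior = {x | ∀ i, 0 < (Cell.basis τ).coord i x} := by
  rw [← Cell.convexHull_eq, AffineBasis.interior_convexHull]

/-- Membership in `τ.interior` also asks each coordinate to be below 1. This follows from positivity
of another coordinate, which exists because `d ≠ 0`. -/
theorem Cell.interior_subset [NeZero d] (τ : Cell d) :
    _root_.interior τ.closedInterior ⊆ τ.interior := by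
  intro x hx
  rw [Cell.interior_closedInterior] at hx
  have hs := (Cell.basis τ).sum_coord_apply_eq_one x
  refine ⟨fun i => (Cell.basis τ).coord i x, hs, fun i => ⟨hx i, ?_⟩,
    (Cell.basis τ).affineCombination_coord_eq_self x⟩
  obtain ⟨j, hj⟩ : ∃ j : Fin (d + 1), j ≠ i := by
    have : Nontrivial (Fin (d + 1)) := Fin.nontrivial_iff_two_le.2 (by
      have := NeZero.pos d; omega)
    exact exists_ne i
  rw [← hs, ← Finset.add_sum_erase _ _ (Finset.mem_univ i)]
  have : 0 < ∑ k ∈ Finset.univ.erase i, (Cell.basis τ).coord k x :=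
    Finset.sum_pos (fun k _ => hx k) ⟨j, by simpa using hj⟩
  linarith

theorem Cell.convex (τ : Cell d) : Convex ℝ τ.closedInterior := by
  rw [← Cell.convexHull_eq]; exact convex_convexHull ..

theorem Cell.isCompact (τ : Cell d) : IsCompact τ.closedInterior := τ.isCompact_closedInterior

theorem Cell.isBounded (τ : Cell d) : Bornology.IsBounded τ.closedInterior :=
  (Cell.isCompact τ).isBounded

theorem Cell.measurableSet (τ : Cell d) : MeasurableSet τ.closedInterior :=
  (Cell.isCompact τ).measurableSet

theorem Cell.ae_mem_interior (τ : Cell d) :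
    ∀ᵐ x ∂volume.restrict τ.closedInterior, x ∈ _root_.interior τ.closedInterior := by
  rw [ae_restrict_iff' (Cell.measurableSet τ)]
  have h0 : ∀ᵐ x, x ∉ frontier τ.closedInterior :=
    measure_eq_zero_iff_ae_notMem.1 ((Cell.convex τ).addHaar_frontier volume)
  filter_upwards [h0] with x hx hxτ
  by_contra hc
  exact hx ⟨subset_closure hxτ, hc⟩

theorem Cell.dist_le_cellDiam (τ : Cell d) {x y : E d} (hx : x ∈ τ.closedInterior)
    (hy : y ∈ τ.closedInterior) : dist x y ≤ Triangulation.cellDiam τ :=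
  dist_le_diam_of_mem (Cell.isBounded τ) hx hy

/-- The signed distances to the facets are 1-Lipschitz and all equal the inradius at the incenter,
so they stay positive on the ball; each is a barycentric coordinate times a height. -/
theorem Cell.ball_incenter_subset [NeZero d] (τ : Cell d) :
    ball τ.incenter τ.inradius ⊆ τ.closedInterior := by
  intro x hx
  rw [Cell.closedInterior_eq]
  intro i
  have hlip : |τ.signedInfDist i x - τ.signedInfDist i τ.incenter| ≤ dist x τ.incenter := by
    rw [Affine.Simplex.signedInfDist, AffineSubspace.signedInfDist_def, signedDist_triangle_left]
    rw [dist_comm]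
    exact abs_signedDist_le_dist ..
  rw [Affine.Simplex.signedInfDist_incenter] at hlip
  have hpos : 0 < τ.signedInfDist i x := by
    have := (abs_le.1 hlip).1
    have := mem_ball.1 hx
    linarith
  rw [← (Cell.basis τ).affineCombination_coord_eq_self x] at hpos
  have hsum := (Cell.basis τ).sum_coord_apply_eq_one x
  have := τ.signedInfDist_affineCombination i hsum
  have h2 : 0 < (Cell.basis τ).coord i x * ‖τ.points i -ᵥ
      ((τ.faceOpposite i).orthogonalProjectionSpan (τ.points i) : E d)‖ := by
    rw [← this]; exact hpos
  exact (pos_of_mul_pos_left h2 (norm_nonneg _)).le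

theorem Cell.incenter_mem [NeZero d] (τ : Cell d) : τ.incenter ∈ τ.closedInterior :=
  Cell.ball_incenter_subset τ (mem_ball_self τ.inradius_pos)

/-- A touchpoint of the insphere is at distance `τ.inradius` from the incenter and lies in the
closed simplex as a limit of points of the inscribed ball. -/
theorem Cell.inradius_le_cellDiam [NeZero d] (τ : Cell d) :
    τ.inradius ≤ Triangulation.cellDiam τ := by
  have h := τ.dist_incenter 0
  rw [← h, dist_comm]
  have : τ.touchpoint ∅ 0 ∈ closedBall τ.incenter τ.inradius := by
    rw [mem_closedBall, dist_comm]; exact h.le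
  rw [← closure_ball _ τ.inradius_pos.ne'] at this
  exact Cell.dist_le_cellDiam τ
    ((Cell.isCompact τ).isClosed.closure_subset_iff.2 (Cell.ball_incenter_subset τ) this)
    (Cell.incenter_mem τ)

end CellGeometry

/-! ### Integration over a triangulation, element by element -/

namespace Triangulation

variable {d : ℕ} {Ω : ConvexPolyhedralDomain d}

/-- A common point of two distinct closed elements lies on one of their frontiers, and frontiers of
convex sets are null. -/
theorem aedisjoint [NeZero d] (T : Triangulation Ω) {τ τ' : Cell d} (hτ : τ ∈ T.cells)
    (hτ' : τ' ∈ T.cells) (hne : τ ≠ τ') :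
    AEDisjoint volume τ.closedInterior τ'.closedInterior := by
  have h1 := (Cell.convex τ).addHaar_frontier volume
  have h2 := (Cell.convex τ').addHaar_frontier volume
  refine measure_mono_null (t := frontier τ.closedInterior ∪ frontier τ'.closedInterior) ?_
    (measure_union_null h1 h2)
  rintro x ⟨hx, hx'⟩
  by_contra hc
  simp only [mem_union, frontier, mem_sdiff, not_or, not_and, not_not] at hc
  exact disjoint_left.1 (T.disjoint τ hτ τ' hτ' hne)
    (Cell.interior_subset τ (hc.1 (subset_closure hx)))
    (Cell.interior_subset τ' (hc.2 (subset_closure hx')))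

theorem integral_biUnion [NeZero d] (T : Triangulation Ω) {S : Finset (Cell d)} (hS : S ⊆ T.cells)
    {F : Type*} [NormedAddCommGroup F] [NormedSpace ℝ F]
    {g : E d → F} (hg : ∀ τ ∈ S, IntegrableOn g τ.closedInterior) :
    ∫ x in ⋃ τ ∈ S, τ.closedInterior, g x = ∑ τ ∈ S, ∫ x in τ.closedInterior, g x := by
  classical
  induction S using Finset.induction_on with
  | empty => simp
  | insert τ S hτ ih =>
    simp only [Finset.set_biUnion_insert, Finset.sum_insert hτ]
    rw [setIntegral_union₀, ih]
    · exact (Finset.subset_insert _ _).trans hS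
    · exact fun τ' hτ' => hg τ' (Finset.mem_insert_of_mem hτ')
    · rw [AEDisjoint, inter_iUnion₂]
      refine (measure_biUnion_null_iff S.countable_toSet).2 fun τ' hτ' => ?_
      refine T.aedisjoint (hS (Finset.mem_insert_self _ _)) (hS (Finset.mem_insert_of_mem hτ')) ?_
      rintro rfl
      exact hτ hτ'
    · exact (Finset.measurableSet_biUnion S fun τ' _ => Cell.measurableSet τ').nullMeasurableSet
    · exact hg τ (Finset.mem_insert_self _ _)
    · exact integrableOn_finset_iUnion.2 fun τ' hτ' => hg τ' (Finset.mem_insert_of_mem hτ')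

end Triangulation

theorem ConvexPolyhedralDomain.carrier_ae_eq_closure {d : ℕ} (Ω : ConvexPolyhedralDomain d) :
    Ω.carrier =ᵐ[volume] closure Ω.carrier := by
  have h0 : ∀ᵐ x, x ∉ frontier Ω.carrier :=
    measure_eq_zero_iff_ae_notMem.1 (Ω.convex.addHaar_frontier volume)
  filter_upwards [h0] with x hx
  rw [Ω.isOpen.frontier_eq] at hx
  refine propext ⟨fun h => subset_closure h, fun h => ?_⟩
  by_contra hc
  exact hx ⟨h, hc⟩

namespace Triangulation

variable {d : ℕ} {Ω : ConvexPolyhedralDomain d}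

theorem closedInterior_subset (T : Triangulation Ω) {τ : Cell d} (hτ : τ ∈ T.cells) :
    τ.closedInterior ⊆ closure Ω.carrier := by
  rw [T.cover]
  exact subset_biUnion_of_mem (u := fun τ : Cell d => τ.closedInterior) hτ

theorem exists_mem_cell (T : Triangulation Ω) {x : E d} (hx : x ∈ closure Ω.carrier) :
    ∃ τ ∈ T.cells, x ∈ τ.closedInterior := by
  rw [T.cover] at hx
  simpa using hx

theorem cells_nonempty (T : Triangulation Ω) : T.cells.Nonempty := by
  obtain ⟨x, hx⟩ := Ω.nonempty
  obtain ⟨τ, hτ, -⟩ := T.exists_mem_cell (subset_closure hx)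
  exact ⟨τ, hτ⟩

theorem integral_eq_sum [NeZero d] (T : Triangulation Ω)
    {F : Type*} [NormedAddCommGroup F] [NormedSpace ℝ F]
    {g : E d → F} (hg : ∀ τ ∈ T.cells, IntegrableOn g τ.closedInterior) :
    ∫ x in Ω.carrier, g x = ∑ τ ∈ T.cells, ∫ x in τ.closedInterior, g x := by
  rw [setIntegral_congr_set Ω.carrier_ae_eq_closure, T.cover]
  exact T.integral_biUnion subset_rfl hg

theorem _root_.BPX.Cell.interior_subset_carrier (T : Triangulation Ω) {τ : Cell d}
    (hτ : τ ∈ T.cells) : _root_.interior τ.closedInterior ⊆ Ω.carrier := by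
  refine (interior_mono (T.closedInterior_subset hτ)).trans ?_
  rw [Ω.convex.interior_closure_eq_interior_of_nonempty_interior
    (by rw [Ω.isOpen.interior_eq]; exact Ω.nonempty), Ω.isOpen.interior_eq]

end Triangulation

/-! ### Lipschitz continuity and gradients of finite element functions -/

section Lipschitz

open Filter Topology
open scoped NNReal

/-- A continuous function on `[0, 1]` which is Lipschitz on each member of a finite closed cover
is Lipschitz. -/
theorem norm_sub_le_of_finite_closed_cover {ι : Type*} {s : Finset ι} {A : ι → Set ℝ}
    {g : ℝ → ℝ} {C : ℝ} (hg : Continuous g) (hA : ∀ i ∈ s, IsClosed (A i))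
    (hcov : ∀ t, ∃ i ∈ s, t ∈ A i)
    (hlip : ∀ i ∈ s, ∀ x ∈ A i, ∀ y ∈ A i, |g x - g y| ≤ C * |x - y|) :
    |g 1 - g 0| ≤ C := by
  have key : ∀ ⦃x⦄, x ∈ Icc (0 : ℝ) 1 → ‖g x - g 0‖ ≤ C * x := by
    -- The comparison theorem needs a strict derivative inequality, hence the slightly larger slope
    -- `C'`.
    have hlim : ∀ C' > C, ∀ ⦃x⦄, x ∈ Icc (0 : ℝ) 1 → ‖g x - g 0‖ ≤ C' * x := by
      intro C' hC'
      refine image_norm_le_of_liminf_right_slope_norm_lt_deriv_boundary (f := fun x => g x - g 0)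
        (f' := fun _ => C) (B' := fun _ => C') (hg.sub continuous_const).continuousOn ?_
        (by simp) (by fun_prop) (fun x _ => ?_) (fun x _ _ => hC')
      · intro x _ r hr
        have h1 : ∃ᶠ z in 𝓝[>] x, ∃ i ∈ s, z ∈ A i :=
          (Eventually.of_forall fun z => hcov z).frequently
        -- By finiteness one closed set meets every right neighbourhood of `x`; being closed it
        -- contains `x`, so its Lipschitz bound controls these difference quotients.
        obtain ⟨i, hi, hfr⟩ : ∃ i ∈ s, ∃ᶠ z in 𝓝[>] x, z ∈ A i := by
          by_contra hcon
          push Not at hcon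
          have h2 : ∀ᶠ z in 𝓝[>] x, ∀ i ∈ s, z ∉ A i := by
            rw [eventually_all_finset]
            exact hcon
          exact h1 (h2.mono fun z hz ⟨i, hi, hzi⟩ => hz i hi hzi)
        have hxA : x ∈ A i :=
          (hA i hi).mem_of_frequently_of_tendsto hfr nhdsWithin_le_nhds
        refine (hfr.and_eventually self_mem_nhdsWithin).mono ?_
        rintro z ⟨hz, hxz : x < z⟩
        refine lt_of_le_of_lt ?_ hr
        rw [slope_def_field, div_le_iff₀ (sub_pos.2 hxz)]
        have h3 := hlip i hi z hz x hxA
        rw [abs_of_pos (sub_pos.2 hxz)] at h3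
        refine le_trans ?_ h3
        have := norm_sub_norm_le (g z - g 0) (g x - g 0)
        rw [sub_sub_sub_cancel_right] at this
        exact this
      · simpa using ((hasDerivAt_id x).const_mul C').hasDerivWithinAt
    intro x hx
    refine le_of_forall_pos_le_add fun ε hε => ?_
    have := hlim (C + ε) (by linarith) hx
    refine this.trans ?_
    nlinarith [hx.1, hx.2]
  simpa using key (right_mem_Icc.2 zero_le_one)

theorem lipschitzWith_of_finite_closed_cover {V : Type*} [NormedAddCommGroup V] [NormedSpace ℝ V]
    {ι : Type*} {s : Finset ι} {A : ι → Set V} {g : V → ℝ} {C : ℝ≥0} (hg : Continuous g)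
    (hA : ∀ i ∈ s, IsClosed (A i)) (hcov : ∀ x, ∃ i ∈ s, x ∈ A i)
    (hlip : ∀ i ∈ s, LipschitzOnWith C g (A i)) : LipschitzWith C g := by
  refine LipschitzWith.of_dist_le_mul fun x y => ?_
  let p : ℝ → V := fun t => y + t • (x - y)
  have hp : Continuous p := by fun_prop
  have := norm_sub_le_of_finite_closed_cover (s := s) (A := fun i => p ⁻¹' A i) (g := g ∘ p)
    (C := C * dist x y) (hg.comp hp) (fun i hi => (hA i hi).preimage hp) (fun t => hcov (p t))
    (fun i hi t ht u hu => by
      have h1 := (hlip i hi).dist_le_mul _ ht _ hu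
      have h2 : dist (p t) (p u) = |t - u| * dist x y := by
        have : p t - p u = (t - u) • (x - y) := by simp only [p]; module
        rw [dist_eq_norm, this, norm_smul, Real.norm_eq_abs, dist_eq_norm]
      rw [h2] at h1
      calc _ ≤ _ := h1
        _ = _ := by ring)
  simpa [p, Real.dist_eq] using this

variable {d : ℕ} {Ω : ConvexPolyhedralDomain d}

/-- The closed elements together with the closed complement of `Ω` (index `none`), where `v` is
zero, form a finite closed cover of the whole space. -/
theorem Triangulation.exists_lipschitzWith (T : Triangulation Ω) {v : E d → ℝ}
    (hv : v ∈ T.feSpace) : ∃ L : ℝ≥0, LipschitzWith L v := by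
  classical
  obtain ⟨hc, h0, hA⟩ := hv
  have hA' : ∀ τ : Cell d, ∃ K : ℝ≥0, τ ∈ T.cells → LipschitzOnWith K v τ.closedInterior := by
    intro τ
    by_cases hτ : τ ∈ T.cells
    · obtain ⟨A, hAv⟩ := hA τ hτ
      let B : E d →ᴬ[ℝ] ℝ := ⟨A, A.continuous_of_finiteDimensional⟩
      refine ⟨‖B.contLinear‖₊, fun _ => ?_⟩
      have hB : LipschitzWith ‖B.contLinear‖₊ A := by
        refine LipschitzWith.of_dist_le_mul fun x y => ?_
        rw [dist_eq_norm, dist_eq_norm]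
        have : A x - A y = B.contLinear (x - y) := by
          have := A.linearMap_vsub x y
          simpa using this.symm
        rw [this]
        exact B.contLinear.le_opNorm _
      intro x hx y hy
      rw [hAv hx, hAv hy]
      exact hB x y
    · exact ⟨0, fun h => absurd h hτ⟩
  choose K hK using hA'
  refine ⟨T.cells.sup K, lipschitzWith_of_finite_closed_cover (s := T.cells.insertNone)
    (A := fun o : Option (Cell d) => o.elim Ω.carrierᶜ fun τ => τ.closedInterior) hc ?_ ?_ ?_⟩
  · rintro (_ | τ) _
    · exact Ω.isOpen.isClosed_compl
    · exact (Cell.isCompact τ).isClosed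
  · intro x
    by_cases hx : x ∈ Ω.carrier
    · obtain ⟨τ, hτ, hxτ⟩ := T.exists_mem_cell (subset_closure hx)
      exact ⟨some τ, by simpa using hτ, hxτ⟩
    · exact ⟨none, by simp, hx⟩
  · rintro (_ | τ) hτ
    · intro x hx y hy
      simp [h0 x hx, h0 y hy]
    · have hτ' : τ ∈ T.cells := by simpa using hτ
      exact (hK τ hτ').weaken (Finset.le_sup hτ')

/-- The gradient of a finite element function is constant inside every element. -/
theorem Triangulation.exists_gradient_eq (T : Triangulation Ω) {v : E d → ℝ} (hv : v ∈ T.feSpace)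
    {τ : Cell d} (hτ : τ ∈ T.cells) :
    ∃ p : E d, ∀ x ∈ interior τ.closedInterior, gradient v x = p := by
  obtain ⟨A, hA⟩ := hv.2.2 τ hτ
  let B : E d →ᴬ[ℝ] ℝ := ⟨A, A.continuous_of_finiteDimensional⟩
  refine ⟨(InnerProductSpace.toDual ℝ (E d)).symm B.contLinear, fun x hx => ?_⟩
  have h1 : v =ᶠ[𝓝 x] B := by
    filter_upwards [mem_interior_iff_mem_nhds.1 hx] with y hy using hA hy
  rw [gradient, h1.fderiv_eq]
  congr 1
  have h2 : (B : E d → ℝ) = fun y => B.contLinear y + B 0 := by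
    ext y
    have := B.toAffineMap.linearMap_vsub y 0
    have h3 : B.contLinear y = B y - B 0 := by simpa using this
    rw [h3]; ring
  rw [h2]
  exact (B.contLinear.hasFDerivAt.add_const _).fderiv

end Lipschitz

end BPX

namespace BPX

/-! ### Directional derivatives integrated over a convex set -/

section Strip

open Metric
open scoped NNReal

theorem integral_mul_le_sqrt_mul_sqrt {X : Type*} [MeasurableSpace X] {μ : Measure X}
    {f g : X → ℝ} (hf : Integrable (fun x => f x ^ 2) μ) (hg : Integrable (fun x => g x ^ 2) μ)
    (hfg : Integrable (fun x => f x * g x) μ) :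
    ∫ x, f x * g x ∂μ ≤ √(∫ x, f x ^ 2 ∂μ) * √(∫ x, g x ^ 2 ∂μ) := by
  set a := ∫ x, f x ^ 2 ∂μ
  set b := ∫ x, g x ^ 2 ∂μ
  set c := ∫ x, f x * g x ∂μ
  have ha : 0 ≤ a := integral_nonneg fun _ => sq_nonneg _
  have h : ∀ t : ℝ, 0 ≤ b * (t * t) + (-2 * c) * t + a := by
    intro t
    have h1 : 0 ≤ ∫ x, (f x - t * g x) ^ 2 ∂μ := integral_nonneg fun _ => sq_nonneg _
    have h2 : ∀ x, (f x - t * g x) ^ 2 = f x ^ 2 - 2 * t * (f x * g x) + t ^ 2 * g x ^ 2 :=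
      fun x => by ring
    have i1 : Integrable (fun x => f x ^ 2 - 2 * t * (f x * g x)) μ := hf.sub (hfg.const_mul _)
    simp_rw [h2] at h1
    rw [integral_add i1 (hg.const_mul _), integral_sub hf (hfg.const_mul _), integral_const_mul,
      integral_const_mul] at h1
    change 0 ≤ a - 2 * t * c + t ^ 2 * b at h1
    linarith
  have hd := discrim_le_zero h
  rw [discrim] at hd
  rw [← Real.sqrt_mul ha]
  exact Real.le_sqrt_of_sq_le (by nlinarith)

variable {d : ℕ}

theorem setIntegral_le_sqrt_volume_mul {N S : Set (E d)} {f : E d → ℝ} (hNS : N ⊆ S)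
    (hS : Bornology.IsBounded S) (hf : Measurable f) {C : ℝ} (hC : ∀ x ∈ S, |f x| ≤ C)
    (hSm : MeasurableSet S) (hNm : MeasurableSet N) :
    ∫ x in N, f x ≤ √(volume.real N) * √(∫ x in S, f x ^ 2) := by
  have hN := hS.subset hNS
  have i2 : IntegrableOn (fun x => f x ^ 2) S := by
    refine integrableOn_of_norm_le hS (hf.pow_const 2).aestronglyMeasurable (C := C ^ 2) ?_
    filter_upwards [ae_restrict_mem hSm] with x hx
    rw [Real.norm_eq_abs, abs_pow]
    have := hC x hx
    gcongr
  have i1 : IntegrableOn f N := by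
    refine integrableOn_of_norm_le hN hf.aestronglyMeasurable (C := C) ?_
    filter_upwards [ae_restrict_mem hNm] with x hx using hC x (hNS hx)
  have : IsFiniteMeasure (volume.restrict N) := ⟨by simpa using hN.measure_lt_top⟩
  have h := integral_mul_le_sqrt_mul_sqrt (μ := volume.restrict N) (f := fun _ => 1) (g := f)
    (by simp) (i2.mono_set hNS) (by simp only [one_mul]; exact i1)
  simp only [one_mul, one_pow, integral_const, MeasurableSet.univ, measureReal_restrict_apply,
    univ_inter, smul_eq_mul, mul_one] at h
  refine h.trans ?_
  refine mul_le_mul_of_nonneg_left (Real.sqrt_le_sqrt ?_) (Real.sqrt_nonneg _)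
  exact setIntegral_mono_set i2 (ae_of_all _ fun x => sq_nonneg _) hNS.eventuallyLE

theorem lineDeriv_eq_inner_gradient {f : E d → ℝ} {x : E d} (hf : DifferentiableAt ℝ f x)
    (p : E d) : lineDeriv ℝ f x p = inner ℝ p (gradient f x) := by
  rw [hf.lineDeriv_eq_fderiv, real_inner_comm]
  exact (InnerProductSpace.toDual_symm_apply (𝕜 := ℝ)).symm

/-- The integral of a directional derivative over a convex set is controlled by a boundary strip
of width proportional to `s`. -/
theorem integral_inner_gradient_le {S : Set (E d)} (hSc : IsCompact S) (hS : Convex ℝ S)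
    {x₀ : E d} {r s : ℝ} (hs : 0 < s) (hsr : s < r) (hball : ball x₀ r ⊆ S) {w : E d → ℝ}
    {L : ℝ≥0} (hw : LipschitzWith L w) (p : E d) :
    ∫ x in S, inner ℝ p (gradient w x) ≤ ‖p‖ * √(volume.real S * (d * (s / r))) *
      (√(∫ x in S, ‖gradient w x‖ ^ 2) + √(∫ x in S, w x ^ 2) / s) := by
  have hr : 0 < r := hs.trans hsr
  have hSm := hSc.measurableSet
  have hSb := hSc.isBounded
  let S' : Set (E d) := (fun y => y + x₀) ⁻¹' S
  have hS'c : Convex ℝ S' := hS.translate_preimage_left x₀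
  have hS'b : ball 0 r ⊆ S' := fun y hy => hball (by simpa [dist_eq_norm] using hy)
  have hS'n : S' ∈ nhds (0 : E d) := Filter.mem_of_superset (ball_mem_nhds 0 hr) hS'b
  have hS'cl : IsClosed S' := hSc.isClosed.preimage (by fun_prop)
  -- The gauge of `S` centred at `x₀` is `1/r`-Lipschitz because `S` contains the ball of radius
  -- `r`, which makes the cutoff `η` below `1/s`-Lipschitz.
  let g : E d → ℝ := fun x => gauge S' (x - x₀)
  have hgS : ∀ x, g x ≤ 1 ↔ x ∈ S := fun x => by
    simp only [g]
    rw [gauge_le_one_iff_mem_closure hS'c hS'n, hS'cl.closure_eq]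
    simp [S']
  let r' : ℝ≥0 := ⟨r, hr.le⟩
  have hgL : LipschitzWith r'⁻¹ g := by
    have h1 := hS'c.lipschitzWith_gauge (r := r') (by exact hr) hS'b
    have h2 := h1.comp (LipschitzWith.id.sub (LipschitzWith.const x₀))
    simpa [Function.comp_def] using h2
  have hg0 : ∀ x, 0 ≤ g x := fun x => gauge_nonneg _
  let η : E d → ℝ := fun x => max 0 (min 1 ((1 - g x) * (r / s)))
  let D : ℝ≥0 := ⟨s⁻¹, (inv_pos.2 hs).le⟩
  have hηL : LipschitzWith D η := by
    refine LipschitzWith.const_max (LipschitzWith.const_min ?_ 1) 0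
    refine LipschitzWith.of_dist_le_mul fun x y => ?_
    have h1 := hgL.dist_le_mul x y
    rw [Real.dist_eq] at h1 ⊢
    have h2 : (1 - g x) * (r / s) - (1 - g y) * (r / s) = -(g x - g y) * (r / s) := by ring
    rw [h2, abs_mul, abs_neg, abs_of_pos (div_pos hr hs)]
    have h3 : ((r'⁻¹ : ℝ≥0) : ℝ) = r⁻¹ := rfl
    rw [h3] at h1
    calc |g x - g y| * (r / s) ≤ r⁻¹ * dist x y * (r / s) := by gcongr
      _ = s⁻¹ * dist x y := by field_simp
  have hη0 : ∀ x, 0 ≤ η x := fun x => le_max_left _ _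
  have hη1 : ∀ x, η x ≤ 1 := fun x => max_le zero_le_one (min_le_left _ _)
  have hηout : ∀ x ∉ S, η x = 0 := fun x hx => by
    have : 1 < g x := lt_of_not_ge fun h => hx ((hgS x).1 h)
    have h2 : (1 - g x) * (r / s) ≤ 0 :=
      mul_nonpos_of_nonpos_of_nonneg (by linarith) (div_pos hr hs).le
    exact max_eq_left ((min_le_right _ _).trans h2)
  have hηsupp : HasCompactSupport η := HasCompactSupport.intro hSc hηout
  let N : Set (E d) := S ∩ {x | η x < 1}
  have hNS : N ⊆ S := inter_subset_left
  have hNm : MeasurableSet N :=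
    hSm.inter (measurableSet_lt hηL.continuous.measurable measurable_const)
  -- the volume of the strip
  have hNvol : volume.real N ≤ volume.real S * (d * (s / r)) := by
    set θ : ℝ := 1 - s / r
    have hθ0 : 0 ≤ θ := by
      have : s / r < 1 := (div_lt_one hr).2 hsr
      simp only [θ]; linarith
    -- The cutoff equals 1 on this contracted copy of `S`, so the strip lies in the difference;
    -- Bernoulli's inequality bounds `1 - (1 - s/r) ^ d` by `d s / r`.
    let H : Set (E d) := AffineMap.homothety x₀ θ '' S
    have hHc : IsCompact H := hSc.image (AffineMap.homothety_continuous x₀ θ)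
    have hH1 : ∀ x ∈ H, g x ≤ θ := by
      rintro _ ⟨y, hy, rfl⟩
      simp only [g, AffineMap.homothety_apply, vsub_eq_sub, vadd_eq_add, add_sub_cancel_right]
      rw [gauge_smul_of_nonneg hθ0, smul_eq_mul]
      exact mul_le_of_le_one_right hθ0 ((hgS y).2 hy)
    have hHS : H ⊆ S := fun x hx => (hgS x).1 ((hH1 x hx).trans (by
      simp only [θ]; have := div_pos hs hr; linarith))
    have hNH : N ⊆ S \ H := by
      rintro x ⟨hxS, hxη⟩
      refine ⟨hxS, fun hxH => ?_⟩
      have h1 := hH1 x hxH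
      have h2 : 1 ≤ (1 - g x) * (r / s) := by
        have : s / r ≤ 1 - g x := by simp only [θ] at h1; linarith
        calc (1 : ℝ) = s / r * (r / s) := by field_simp
          _ ≤ _ := by gcongr
      have : η x = 1 := by
        simp only [η]; rw [min_eq_left h2, max_eq_right zero_le_one]
      exact absurd hxη (by simp [this])
    have hHvol : volume.real H = θ ^ d * volume.real S := by
      simp only [H, measureReal_def, Measure.addHaar_image_homothety, ENNReal.toReal_mul]
      rw [ENNReal.toReal_ofReal (abs_nonneg _), abs_of_nonneg (by positivity)]
      simp
    calc volume.real N ≤ volume.real (S \ H) :=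
          measureReal_mono hNH (hSb.subset sdiff_subset).measure_lt_top.ne
      _ = volume.real S - volume.real H :=
          measureReal_sdiff hHS hHc.measurableSet hSb.measure_lt_top.ne
      _ = volume.real S * (1 - θ ^ d) := by rw [hHvol]; ring
      _ ≤ volume.real S * (d * (s / r)) := by
          gcongr
          have hb := one_add_mul_le_pow (a := -(s / r)) (by
            have : s / r < 1 := (div_lt_one hr).2 hsr
            linarith) d
          have : θ = 1 + -(s / r) := by simp only [θ]; ring
          rw [this]; linarith
  -- the cutoff has derivative supported in the strip
  have hηd : ∀ x, |lineDeriv ℝ η x (-p) * w x| ≤ N.indicator (fun x => ‖p‖ * s⁻¹ * |w x|) x := by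
    intro x
    -- Off the strip `η` attains its global maximum 1 or minimum 0, so its directional derivative
    -- vanishes at every such point.
    have h0 : (∀ y, η y ≤ η x) ∨ (∀ y, η x ≤ η y) → lineDeriv ℝ η x (-p) = 0 := by
      rintro (h | h)
      · refine IsLocalMax.deriv_eq_zero (Filter.Eventually.of_forall fun t => ?_)
        simpa using h _
      · refine IsLocalMin.deriv_eq_zero (Filter.Eventually.of_forall fun t => ?_)
        simpa using h _
    by_cases hx : x ∈ N
    · rw [indicator_of_mem hx, abs_mul]
      gcongr
      have := norm_lineDeriv_le_of_lipschitz ℝ hηL (x₀ := x) (v := -p)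
      rw [norm_neg, Real.norm_eq_abs] at this
      exact this.trans_eq (mul_comm _ _)
    · rw [indicator_of_notMem hx, h0, zero_mul, abs_zero]
      by_cases hxS : x ∈ S
      · left
        have : 1 ≤ η x := not_lt.1 fun h => hx ⟨hxS, h⟩
        exact fun y => (hη1 y).trans this
      · right
        rw [hηout x hxS]
        exact hη0
  have hgm := measurable_gradient w
  have hwm := hw.continuous.measurable
  have hηm := hηL.continuous.measurable
  obtain ⟨B, hB⟩ := hSc.exists_bound_of_continuousOn hw.continuous.continuousOn
  have hpw : ∀ x, |inner ℝ p (gradient w x)| ≤ ‖p‖ * ‖gradient w x‖ := fun x =>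
    abs_real_inner_le_norm _ _
  have hpm : Measurable fun x => inner ℝ p (gradient w x) := by fun_prop
  have hpL : ∀ x, |inner ℝ p (gradient w x)| ≤ ‖p‖ * L := fun x => by
    have h1 := hpw x
    have h2 := norm_gradient_le hw x
    exact h1.trans (by gcongr)
  have i1 : IntegrableOn (fun x => inner ℝ p (gradient w x)) S :=
    integrableOn_of_norm_le hSb hpm.aestronglyMeasurable (ae_of_all _ hpL)
  have i2 : IntegrableOn (fun x => inner ℝ p (gradient w x) * η x) S := by
    refine integrableOn_of_norm_le hSb (hpm.mul hηm).aestronglyMeasurable (C := ‖p‖ * L)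
      (ae_of_all _ fun x => ?_)
    rw [Real.norm_eq_abs, abs_mul, abs_of_nonneg (hη0 x)]
    exact (mul_le_of_le_one_right (abs_nonneg _) (hη1 x)).trans (hpL x)
  have hsplit : ∫ x in S, inner ℝ p (gradient w x) =
      (∫ x in S, inner ℝ p (gradient w x) * (1 - η x)) +
        ∫ x in S, inner ℝ p (gradient w x) * η x := by
    rw [← integral_add]
    · refine integral_congr_ae (ae_of_all _ fun x => ?_)
      simp only; ring
    · refine (i1.sub i2).congr (ae_of_all _ fun x => ?_)
      simp only [Pi.sub_apply]; ring
    · exact i2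
  have iN : ∀ f : E d → ℝ, Measurable f → (∃ C, ∀ x ∈ S, |f x| ≤ C) → IntegrableOn f N := by
    rintro f hf ⟨C, hC⟩
    refine integrableOn_of_norm_le (hSb.subset hNS) hf.aestronglyMeasurable (C := C) ?_
    filter_upwards [ae_restrict_mem hNm] with x hx using hC x (hNS hx)
  have h1 : ∫ x in S, inner ℝ p (gradient w x) * (1 - η x) ≤
      ‖p‖ * (√(volume.real N) * √(∫ x in S, ‖gradient w x‖ ^ 2)) := by
    calc ∫ x in S, inner ℝ p (gradient w x) * (1 - η x)
        ≤ ∫ x in S, N.indicator (fun x => ‖p‖ * ‖gradient w x‖) x := by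
          refine setIntegral_mono_on ?_ ?_ hSm fun x hx => ?_
          · refine (i1.sub i2).congr (ae_of_all _ fun x => ?_)
            simp only [Pi.sub_apply]; ring
          · rw [integrableOn_indicator_iff hNm, inter_eq_left.2 hNS]
            exact iN _ (by fun_prop) ⟨‖p‖ * L, fun x _ => by
              rw [abs_mul, abs_norm, abs_norm]
              have := norm_gradient_le hw x
              gcongr⟩
          · by_cases hxN : x ∈ N
            · rw [indicator_of_mem hxN]
              have a1 := (le_abs_self _).trans (hpw x)
              have a2 : 0 ≤ 1 - η x := by linarith [hη1 x]
              have a3 : 0 ≤ ‖p‖ * ‖gradient w x‖ := by positivity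
              nlinarith [hη0 x]
            · have : 1 ≤ η x := not_lt.1 fun h => hxN ⟨hx, h⟩
              rw [indicator_of_notMem hxN, le_antisymm (hη1 x) this]
              simp
      _ = ‖p‖ * ∫ x in N, ‖gradient w x‖ := by
          rw [setIntegral_indicator hNm, inter_eq_right.2 hNS, integral_const_mul]
      _ ≤ _ := by
          refine mul_le_mul_of_nonneg_left ?_ (norm_nonneg _)
          exact setIntegral_le_sqrt_volume_mul hNS hSb hgm.norm (C := L)
            (fun x _ => by rw [abs_norm]; exact norm_gradient_le hw x) hSm hNm
  -- Integration by parts has no boundary term: `w` need not vanish on the boundary of `S`, but `η`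
  -- is zero outside `S`.
  have h2 : ∫ x in S, inner ℝ p (gradient w x) * η x ≤
      ‖p‖ * s⁻¹ * (√(volume.real N) * √(∫ x in S, w x ^ 2)) := by
    calc ∫ x in S, inner ℝ p (gradient w x) * η x
        = ∫ x, inner ℝ p (gradient w x) * η x := by
          refine setIntegral_eq_integral_of_forall_compl_eq_zero fun x hx => ?_
          rw [hηout x hx, mul_zero]
      _ = ∫ x, lineDeriv ℝ w x p * η x := by
          refine integral_congr_ae ?_
          filter_upwards [hw.ae_differentiableAt] with x hx
          rw [lineDeriv_eq_inner_gradient hx]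
      _ = ∫ x, lineDeriv ℝ η x (-p) * w x := hw.integral_lineDeriv_mul_eq hηL hηsupp p
      _ ≤ ∫ x, N.indicator (fun x => ‖p‖ * s⁻¹ * |w x|) x := by
          have iI : Integrable (N.indicator fun x => ‖p‖ * s⁻¹ * |w x|) := by
            rw [integrable_indicator_iff hNm]
            exact iN _ (by fun_prop) ⟨‖p‖ * s⁻¹ * B, fun x hx => by
              rw [abs_mul, abs_abs, abs_of_nonneg (by positivity)]
              have : |w x| ≤ B := hB x hx
              gcongr⟩
          exact (Real.le_norm_self _).trans
            (norm_integral_le_of_norm_le (f := fun x => lineDeriv ℝ η x (-p) * w x) iI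
              (ae_of_all _ hηd))
      _ = ‖p‖ * s⁻¹ * ∫ x in N, |w x| := by
          rw [integral_indicator hNm, integral_const_mul]
      _ ≤ _ := by
          refine mul_le_mul_of_nonneg_left ?_ (by positivity)
          have := setIntegral_le_sqrt_volume_mul hNS hSb (f := fun x => |w x|) (C := B)
            (by fun_prop) (fun x hx => by rw [abs_abs]; exact hB x hx) hSm hNm
          simpa only [sq_abs] using this
  rw [hsplit]
  calc _ ≤ ‖p‖ * √(volume.real N) *
        (√(∫ x in S, ‖gradient w x‖ ^ 2) + √(∫ x in S, w x ^ 2) / s) := by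
        rw [div_eq_mul_inv]; linarith
    _ ≤ _ := by gcongr

end Strip

end BPX

namespace BPX

/-! ### Friedrichs inequality near supporting hyperplanes -/

section BoundaryStrip

open Filter Topology
open scoped NNReal ENNReal

variable {d : ℕ}

/-- The one-dimensional Friedrichs inequality along a segment, for Lipschitz functions. -/
theorem sq_le_mul_integral_lineDeriv_sq {w : E d → ℝ} {L : ℝ≥0} (hw : LipschitzWith L w)
    {x n : E d} {δ : ℝ} (hδ : 0 ≤ δ) (h0 : w (x + δ • n) = 0) :
    w x ^ 2 ≤ δ * ∫ s in Ioc 0 δ, lineDeriv ℝ w (x + s • n) n ^ 2 := by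
  let φ : ℝ → ℝ := fun s => w (x + s • n)
  have hφ : ∀ s, deriv φ s = lineDeriv ℝ w (x + s • n) n := by
    intro s
    have h1 : (fun t : ℝ => w (x + s • n + t • n)) = fun t => φ (s + t) := by
      ext t; simp only [φ]; congr 1; module
    rw [lineDeriv, h1, deriv_comp_const_add, add_zero]
  have hlip : LipschitzWith (L * ‖n‖₊) φ := by
    refine LipschitzWith.of_dist_le_mul fun s t => ?_
    refine (hw.dist_le_mul _ _).trans_eq ?_
    have : x + s • n - (x + t • n) = (s - t) • n := by module
    rw [dist_eq_norm, this, norm_smul, Real.dist_eq, NNReal.coe_mul, coe_nnnorm, Real.norm_eq_abs]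
    ring
  have hftc := (hlip.lipschitzOnWith (s := uIcc 0 δ)).absolutelyContinuousOnInterval.integral_deriv_eq_sub
  have e0 : φ δ = 0 := h0
  have e1 : φ 0 = w x := by simp [φ]
  rw [e0, e1, intervalIntegral.integral_of_le hδ, zero_sub] at hftc
  have hb : ∀ s, |deriv φ s| ≤ (L * ‖n‖₊ : ℝ≥0) := fun s => norm_deriv_le_of_lipschitz hlip
  have : IsFiniteMeasure (volume.restrict (Ioc 0 δ)) := ⟨by simp⟩
  have hm : Measurable (deriv φ) := measurable_deriv φ
  have i1 : Integrable (deriv φ) (volume.restrict (Ioc 0 δ)) :=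
    Integrable.of_bound hm.aestronglyMeasurable _ (ae_of_all _ hb)
  have i2 : Integrable (fun s => deriv φ s ^ 2) (volume.restrict (Ioc 0 δ)) := by
    refine Integrable.of_bound (hm.pow_const 2).aestronglyMeasurable
      ((L * ‖n‖₊ : ℝ≥0) ^ 2) (ae_of_all _ fun s => ?_)
    rw [Real.norm_eq_abs, abs_pow]
    have := hb s
    gcongr
  have hcs : |∫ s in Ioc 0 δ, deriv φ s| ≤ √δ * √(∫ s in Ioc 0 δ, deriv φ s ^ 2) := by
    have key : ∀ f : ℝ → ℝ, Integrable f (volume.restrict (Ioc 0 δ)) →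
        Integrable (fun s => f s ^ 2) (volume.restrict (Ioc 0 δ)) →
        ∫ s in Ioc 0 δ, f s ≤ √δ * √(∫ s in Ioc 0 δ, f s ^ 2) := by
      intro f hf hf2
      have := integral_mul_le_sqrt_mul_sqrt (μ := volume.restrict (Ioc 0 δ)) (f := fun _ => 1)
        (g := f) (by simp) hf2 (by simp only [one_mul]; exact hf)
      simpa [hδ] using this
    rw [abs_le']
    refine ⟨key _ i1 i2, ?_⟩
    have := key (fun s => -deriv φ s) i1.neg (by simpa using i2)
    simpa [integral_neg] using this
  rw [hftc, abs_neg] at hcs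
  calc w x ^ 2 = |w x| ^ 2 := (sq_abs _).symm
    _ ≤ (√δ * √(∫ s in Ioc 0 δ, deriv φ s ^ 2)) ^ 2 := by gcongr
    _ = δ * ∫ s in Ioc 0 δ, deriv φ s ^ 2 := by
        rw [mul_pow, Real.sq_sqrt hδ, Real.sq_sqrt (integral_nonneg fun _ => sq_nonneg _)]
    _ = _ := by simp_rw [hφ]

variable {m : ℕ} (n : Fin m → E d) (c : Fin m → ℝ)

/-- The points for which the `b`-th hyperplane is the nearest one, ties being broken by the index. -/
def nearestRegion (b : Fin m) : Set (E d) :=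
  {x | ∀ b', c b - inner ℝ (n b) x < c b' - inner ℝ (n b') x ∨
    (c b - inner ℝ (n b) x = c b' - inner ℝ (n b') x ∧ b ≤ b')}

theorem measurableSet_nearestRegion (b : Fin m) : MeasurableSet (nearestRegion n c b) := by
  have hm : ∀ b, Measurable fun x : E d => c b - inner ℝ (n b) x := fun b =>
    Continuous.measurable (by fun_prop)
  simp only [nearestRegion, ofPred_forall]
  refine MeasurableSet.iInter fun b' => ?_
  exact (measurableSet_lt (hm b) (hm b')).union
    ((measurableSet_eq_fun (hm b) (hm b')).inter (MeasurableSet.const _))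

theorem disjoint_nearestRegion {b b' : Fin m} (h : b ≠ b') :
    Disjoint (nearestRegion n c b) (nearestRegion n c b') := by
  refine disjoint_left.2 fun x hx hx' => ?_
  rcases hx b' with h1 | ⟨h1, h1'⟩ <;> rcases hx' b with h2 | ⟨h2, h2'⟩
  · exact lt_asymm h1 h2
  · exact h1.ne' h2
  · exact h2.ne' h1
  · exact h (le_antisymm h1' h2')

theorem exists_mem_nearestRegion [Nonempty (Fin m)] (x : E d) :
    ∃ b, x ∈ nearestRegion n c b ∧ ∀ b', c b - inner ℝ (n b) x ≤ c b' - inner ℝ (n b') x := by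
  obtain ⟨b, -, hb⟩ := Finset.exists_min_image Finset.univ
    (fun b : Fin m => toLex (c b - inner ℝ (n b) x, b)) Finset.univ_nonempty
  have hb' : ∀ b', c b - inner ℝ (n b) x < c b' - inner ℝ (n b') x ∨
    (c b - inner ℝ (n b) x = c b' - inner ℝ (n b') x ∧ b ≤ b') := fun b' => by
    simpa [Prod.Lex.le_iff] using hb b' (Finset.mem_univ _)
  exact ⟨b, hb', fun b' => (hb' b').elim le_of_lt fun h => h.1.le⟩

variable {n c}

/-- Moving along the unit vector `n b` decreases the signed distance to hyperplane `b` at rate 1,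
and no other signed distance decreases faster. Segments towards the nearest hyperplane therefore
stay in its region. -/
theorem add_smul_mem_nearestRegion (hn : ∀ b, ‖n b‖ = 1) {b : Fin m} {x : E d}
    (hx : x ∈ nearestRegion n c b) {s : ℝ} (hs : 0 ≤ s) :
    x + s • n b ∈ nearestRegion n c b := by
  intro b'
  have h1 : inner ℝ (n b') (n b) ≤ 1 := by
    refine (real_inner_le_norm _ _).trans ?_
    rw [hn, hn, one_mul]
  have h2 : inner ℝ (n b) (n b) = (1 : ℝ) := by rw [real_inner_self_eq_norm_sq, hn, one_pow]
  simp only [inner_add_right, real_inner_smul_right, h2]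
  have h3 : s * inner ℝ (n b') (n b) ≤ s * 1 := by gcongr
  rcases hx b' with h | ⟨h, h'⟩
  · left; linarith
  · rcases h3.lt_or_eq with h4 | h4
    · left; linarith
    · right; exact ⟨by linarith, h'⟩

/-- Apply the one-dimensional inequality along `n b` up to the hyperplane, where `w = 0`. Extending
to length `h` and exchanging integrals, translation invariance makes each slice contribute the same
integral over the region: one factor `h` from the inequality, one from the length. -/
theorem lintegral_nearestRegion_le {w : E d → ℝ} {L : ℝ≥0} (hw : LipschitzWith L w)
    (hn : ∀ b, ‖n b‖ = 1) (h0 : ∀ b x, c b ≤ inner ℝ (n b) x → w x = 0) {h : ℝ} (hh : 0 < h)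
    (b : Fin m) :
    ∫⁻ x in nearestRegion n c b ∩
        {x | 0 ≤ c b - inner ℝ (n b) x ∧ c b - inner ℝ (n b) x ≤ h}, ENNReal.ofReal (w x ^ 2) ≤
      ENNReal.ofReal (h ^ 2) *
        ∫⁻ x in nearestRegion n c b, ENNReal.ofReal (‖gradient w x‖ ^ 2) := by
  have hR := measurableSet_nearestRegion n c b
  let ℓ : E d → ℝ := fun x => c b - inner ℝ (n b) x
  have hℓ : Continuous ℓ := by fun_prop
  let H : E d → ℝ≥0∞ := (nearestRegion n c b).indicator fun x =>
    ENNReal.ofReal (lineDeriv ℝ w x (n b) ^ 2)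
  have hld : Measurable fun x => lineDeriv ℝ w x (n b) := measurable_lineDeriv hw.continuous
  have hH : Measurable H := Measurable.indicator (by fun_prop) hR
  have hAm : MeasurableSet (nearestRegion n c b ∩ {x | 0 ≤ ℓ x ∧ ℓ x ≤ h}) :=
    hR.inter ((measurableSet_le measurable_const hℓ.measurable).inter
      (measurableSet_le hℓ.measurable measurable_const))
  have hpt : ∀ x ∈ nearestRegion n c b ∩ {x | 0 ≤ ℓ x ∧ ℓ x ≤ h},
      ENNReal.ofReal (w x ^ 2) ≤ ENNReal.ofReal h * ∫⁻ s in Ioc 0 h, H (x + s • n b) := by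
    rintro x ⟨hxR, hx0, hxh⟩
    have h1 : w (x + ℓ x • n b) = 0 := by
      refine h0 b _ ?_
      have h2 : inner ℝ (n b) (n b) = (1 : ℝ) := by rw [real_inner_self_eq_norm_sq, hn, one_pow]
      rw [inner_add_right, real_inner_smul_right, h2]
      simp only [ℓ]; linarith
    have h2 := sq_le_mul_integral_lineDeriv_sq hw hx0 h1
    refine (ENNReal.ofReal_le_ofReal h2).trans ?_
    rw [ENNReal.ofReal_mul hx0]
    refine mul_le_mul' (ENNReal.ofReal_le_ofReal hxh) ?_
    rw [ofReal_integral_eq_lintegral_ofReal]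
    · refine (setLIntegral_mono' measurableSet_Ioc fun s hs => ?_).trans
        (lintegral_mono_set (Ioc_subset_Ioc_right hxh))
      simp only [H]
      rw [indicator_of_mem (add_smul_mem_nearestRegion hn hxR hs.1.le)]
    · have : IsFiniteMeasure (volume.restrict (Ioc 0 (ℓ x))) := ⟨by simp⟩
      refine Integrable.of_bound ?_ ((L * ‖n b‖) ^ 2) (ae_of_all _ fun s => ?_)
      · exact ((hld.comp (by fun_prop : Measurable fun s : ℝ => x + s • n b)).pow_const
          2).aestronglyMeasurable
      · rw [Real.norm_eq_abs, abs_pow]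
        have := norm_lineDeriv_le_of_lipschitz ℝ hw (x₀ := x + s • n b) (v := n b)
        rw [Real.norm_eq_abs] at this
        gcongr
    · exact ae_of_all _ fun s => sq_nonneg _
  calc _ ≤ ∫⁻ x in nearestRegion n c b ∩ {x | 0 ≤ ℓ x ∧ ℓ x ≤ h},
        ENNReal.ofReal h * ∫⁻ s in Ioc 0 h, H (x + s • n b) := setLIntegral_mono' hAm hpt
    _ ≤ ∫⁻ x, ENNReal.ofReal h * ∫⁻ s in Ioc 0 h, H (x + s • n b) := setLIntegral_le_lintegral _ _
    _ = ENNReal.ofReal h * ∫⁻ x, ∫⁻ s in Ioc 0 h, H (x + s • n b) :=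
        lintegral_const_mul' _ _ ENNReal.ofReal_ne_top
    _ = ENNReal.ofReal h * ∫⁻ s in Ioc 0 h, ∫⁻ x, H (x + s • n b) := by
        rw [lintegral_lintegral_swap]
        exact (hH.comp (by fun_prop : Measurable fun p : E d × ℝ => p.1 + p.2 • n b)).aemeasurable
    _ = ENNReal.ofReal h * ∫⁻ s in Ioc 0 h, ∫⁻ x, H x := by
        simp_rw [lintegral_add_right_eq_self H]
    _ = ENNReal.ofReal (h ^ 2) * ∫⁻ x, H x := by
        rw [lintegral_const, Measure.restrict_apply_univ, Real.volume_Ioc, sub_zero, pow_two,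
          ENNReal.ofReal_mul hh.le]
        ring
    _ ≤ _ := by
        refine mul_le_mul' le_rfl ?_
        rw [← lintegral_indicator hR]
        refine lintegral_mono_ae ?_
        filter_upwards [hw.ae_differentiableAt] with x hx
        refine indicator_le_indicator (ENNReal.ofReal_le_ofReal ?_)
        rw [lineDeriv_eq_inner_gradient hx, ← sq_abs]
        have := abs_real_inner_le_norm (n b) (gradient w x)
        rw [hn, one_mul] at this
        gcongr

theorem gradient_eq_zero_of_notMem_closure {U : Set (E d)} {w : E d → ℝ}
    (h0 : ∀ x ∉ U, w x = 0) {x : E d} (hx : x ∉ closure U) : gradient w x = 0 := by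
  have h1 : w =ᶠ[𝓝 x] fun _ => 0 := by
    filter_upwards [isClosed_closure.isOpen_compl.mem_nhds hx] with y hy
    exact h0 y fun h => hy (subset_closure h)
  rw [gradient, h1.fderiv_eq]
  simp

/-- A Friedrichs inequality in a boundary strip, with a constant independent of the dimension. -/
theorem integral_boundary_strip_le (Ω : ConvexPolyhedralDomain d) {w : E d → ℝ} {L : ℝ≥0}
    (hw : LipschitzWith L w) (hw0 : ∀ x ∉ Ω.carrier, w x = 0) (hn : ∀ b, ‖n b‖ = 1)
    (hΩ : ∀ b, ∀ x ∈ Ω.carrier, inner ℝ (n b) x < c b) {h : ℝ} (hh : 0 < h) :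
    ∫ x in Ω.carrier ∩ {x | ∃ b, c b - inner ℝ (n b) x ≤ h}, w x ^ 2 ≤
      h ^ 2 * ∫ x in Ω.carrier, ‖gradient w x‖ ^ 2 := by
  have hΩm := Ω.isOpen.measurableSet
  rcases isEmpty_or_nonempty (Fin m) with hm | hm
  · simp only [IsEmpty.exists_iff, ofPred_false, inter_empty, setIntegral_empty]
    positivity
  have h0 : ∀ b x, c b ≤ inner ℝ (n b) x → w x = 0 := fun b x hx =>
    hw0 x fun hxΩ => absurd (hΩ b x hxΩ) (not_lt.2 hx)
  have hgm := measurable_gradient w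
  have hwm := hw.continuous.measurable
  set S := Ω.carrier ∩ {x | ∃ b, c b - inner ℝ (n b) x ≤ h}
  have hS : S ⊆ ⋃ b, nearestRegion n c b ∩
      {x | 0 ≤ c b - inner ℝ (n b) x ∧ c b - inner ℝ (n b) x ≤ h} := by
    rintro x ⟨hx, b', hb'⟩
    obtain ⟨b, hb, hmin⟩ := exists_mem_nearestRegion n c x
    refine mem_iUnion.2 ⟨b, hb, ?_, (hmin b').trans hb'⟩
    have := hΩ b x hx
    linarith
  have hlin : ∫⁻ x in S, ENNReal.ofReal (w x ^ 2) ≤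
      ENNReal.ofReal (h ^ 2) * ∫⁻ x in Ω.carrier, ENNReal.ofReal (‖gradient w x‖ ^ 2) := by
    calc _ ≤ ∫⁻ x in ⋃ b, nearestRegion n c b ∩
          {x | 0 ≤ c b - inner ℝ (n b) x ∧ c b - inner ℝ (n b) x ≤ h},
            ENNReal.ofReal (w x ^ 2) := lintegral_mono_set hS
      _ ≤ ∑' b, ∫⁻ x in nearestRegion n c b ∩
          {x | 0 ≤ c b - inner ℝ (n b) x ∧ c b - inner ℝ (n b) x ≤ h},
            ENNReal.ofReal (w x ^ 2) := lintegral_iUnion_le _ _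
      _ ≤ ∑' b, ENNReal.ofReal (h ^ 2) *
          ∫⁻ x in nearestRegion n c b, ENNReal.ofReal (‖gradient w x‖ ^ 2) :=
          ENNReal.tsum_le_tsum fun b => lintegral_nearestRegion_le hw hn h0 hh b
      -- Disjointness of the regions is what keeps the constant independent of the number of
      -- hyperplanes.
      _ = ENNReal.ofReal (h ^ 2) * ∫⁻ x in ⋃ b, nearestRegion n c b,
            ENNReal.ofReal (‖gradient w x‖ ^ 2) := by
          rw [ENNReal.tsum_mul_left, lintegral_iUnion (measurableSet_nearestRegion n c)
            fun b b' hbb => disjoint_nearestRegion n c hbb]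
      _ ≤ ENNReal.ofReal (h ^ 2) * ∫⁻ x, ENNReal.ofReal (‖gradient w x‖ ^ 2) :=
          mul_le_mul' le_rfl (setLIntegral_le_lintegral _ _)
      _ = ENNReal.ofReal (h ^ 2) * ∫⁻ x in closure Ω.carrier,
            ENNReal.ofReal (‖gradient w x‖ ^ 2) := by
          congr 1
          rw [← lintegral_indicator isClosed_closure.measurableSet]
          refine lintegral_congr fun x => ?_
          by_cases hx : x ∈ closure Ω.carrier
          · rw [indicator_of_mem hx]
          · rw [indicator_of_notMem hx, gradient_eq_zero_of_notMem_closure hw0 hx]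
            simp
      _ = _ := by rw [setLIntegral_congr Ω.carrier_ae_eq_closure]
  have i1 := integrableOn_norm_gradient_sq hw Ω.isBounded
  have i2 : IntegrableOn (fun x => w x ^ 2) S :=
    integrableOn_of_continuous (hw.continuous.pow 2) (Ω.isBounded.subset inter_subset_left)
  rw [← ofReal_integral_eq_lintegral_ofReal i2 (ae_of_all _ fun _ => sq_nonneg _),
    ← ofReal_integral_eq_lintegral_ofReal i1 (ae_of_all _ fun _ => sq_nonneg _),
    ← ENNReal.ofReal_mul (sq_nonneg h), ENNReal.ofReal_le_ofReal_iff] at hlin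
  · exact hlin
  · have : 0 ≤ ∫ x in Ω.carrier, ‖gradient w x‖ ^ 2 := integral_nonneg fun _ => sq_nonneg _
    positivity

end BoundaryStrip

end BPX

namespace BPX

/-! ### Quasi-interpolation and approximation in the finite element space -/

section Interpolation

open Filter Topology
open scoped NNReal

variable {d : ℕ}

/-- The affine function with prescribed values at the vertices of a simplex. -/
noncomputable def Cell.interp (τ : Cell d) (c : E d → ℝ) : E d →ᵃ[ℝ] ℝ :=
  ∑ i, c (τ.points i) • (Cell.basis τ).coord i

theorem Cell.interp_apply (τ : Cell d) (c : E d → ℝ) (x : E d) :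
    Cell.interp τ c x = ∑ i, (Cell.basis τ).coord i x * c (τ.points i) := by
  let ev : (E d →ᵃ[ℝ] ℝ) →+ ℝ :=
    { toFun := fun A => A x, map_zero' := rfl, map_add' := fun _ _ => rfl }
  change ev (∑ i, c (τ.points i) • (Cell.basis τ).coord i) = _
  rw [map_sum]
  refine Finset.sum_congr rfl fun i _ => ?_
  change c (τ.points i) * (Cell.basis τ).coord i x = _
  rw [mul_comm]

theorem Cell.interp_point (τ : Cell d) (c : E d → ℝ) (j : Fin (d + 1)) :
    Cell.interp τ c (τ.points j) = c (τ.points j) := by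
  rw [Cell.interp_apply, Finset.sum_eq_single j]
  · rw [← Cell.basis_apply, AffineBasis.coord_apply_eq, one_mul]
  · intro i _ hij
    rw [← Cell.basis_apply τ j, AffineBasis.coord_apply_ne _ hij, zero_mul]
  · simp

variable {Ω : ConvexPolyhedralDomain d}

namespace Triangulation

/-- Conformity puts `x` in the convex hull of the common vertices, where two affine functions
agreeing at those vertices coincide. -/
theorem interp_eq_interp (T : Triangulation Ω) (c : E d → ℝ) {τ τ' : Cell d} (hτ : τ ∈ T.cells)
    (hτ' : τ' ∈ T.cells) {x : E d} (hx : x ∈ τ.closedInterior) (hx' : x ∈ τ'.closedInterior) :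
    Cell.interp τ c x = Cell.interp τ' c x := by
  have h1 : x ∈ convexHull ℝ (Cell.vertices τ ∩ Cell.vertices τ') := by
    rw [← T.conforming τ hτ τ' hτ']; exact ⟨hx, hx'⟩
  have h2 : convexHull ℝ (Cell.vertices τ ∩ Cell.vertices τ') ⊆
      (Cell.interp τ c - Cell.interp τ' c) ⁻¹' {0} := by
    refine convexHull_min ?_ ((convex_singleton (0 : ℝ)).affine_preimage _)
    rintro _ ⟨⟨i, rfl⟩, ⟨j, hj⟩⟩
    have e1 := Cell.interp_point τ c i
    have e2 := Cell.interp_point τ' c j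
    rw [hj] at e2
    simp [e1, e2]
  have h3 := h2 h1
  simpa [sub_eq_zero] using h3

/-- A functional separating `x` from `Ω` attains its maximum over the closure at `x`. Every vertex
with positive weight in `x` must then attain it too, hence lies outside `Ω` and carries the value
zero. -/
theorem interp_eq_zero (T : Triangulation Ω) {c : E d → ℝ} (hc : ∀ a ∉ Ω.carrier, c a = 0)
    {τ : Cell d} (hτ : τ ∈ T.cells) {x : E d} (hx : x ∈ τ.closedInterior) (hxΩ : x ∉ Ω.carrier) :
    Cell.interp τ c x = 0 := by
  obtain ⟨f, hf⟩ := geometric_hahn_banach_open_point Ω.convex Ω.isOpen hxΩ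
  have hfc : ∀ y ∈ closure Ω.carrier, f y ≤ f x := fun y hy =>
    closure_minimal (fun z hz => (hf z hz).le) (isClosed_le f.continuous continuous_const) hy
  rw [Cell.closedInterior_eq] at hx
  rw [Cell.interp_apply]
  refine Finset.sum_eq_zero fun j _ => ?_
  rcases (hx j).eq_or_lt with h0 | h0
  · rw [← h0, zero_mul]
  · rw [hc, mul_zero]
    intro hj
    have hfx : f x = ∑ i, (Cell.basis τ).coord i x * f (τ.points i) := by
      conv_lhs => rw [← (Cell.basis τ).linear_combination_coord_eq_self x]
      rw [map_sum]
      simp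
    have h1 : ∑ i, (Cell.basis τ).coord i x * f (τ.points i) <
        ∑ i, (Cell.basis τ).coord i x * f x := by
      refine Finset.sum_lt_sum (fun i _ => ?_) ⟨j, Finset.mem_univ _, ?_⟩
      · exact mul_le_mul_of_nonneg_left
          (hfc _ (T.closedInterior_subset hτ (τ.point_mem_closedInterior i))) (hx i)
      · exact mul_lt_mul_of_pos_left (hf _ hj) h0
    rw [← Finset.sum_mul, AffineBasis.sum_coord_apply_eq_one, one_mul, ← hfx] at h1
    exact lt_irrefl _ h1

/-- The finite element function with prescribed values at the interior vertices. -/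
theorem exists_interpolant (T : Triangulation Ω) {c : E d → ℝ} (hc : ∀ a ∉ Ω.carrier, c a = 0) :
    ∃ z ∈ T.feSpace, ∀ τ ∈ T.cells, ∀ x ∈ τ.closedInterior, z x = Cell.interp τ c x := by
  classical
  let z : E d → ℝ := fun x =>
    if h : ∃ τ ∈ T.cells, x ∈ τ.closedInterior then Cell.interp h.choose c x else 0
  have hz : ∀ τ ∈ T.cells, ∀ x ∈ τ.closedInterior, z x = Cell.interp τ c x := by
    intro τ hτ x hx
    have h : ∃ τ ∈ T.cells, x ∈ τ.closedInterior := ⟨τ, hτ, hx⟩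
    simp only [z, dif_pos h]
    exact T.interp_eq_interp c h.choose_spec.1 hτ h.choose_spec.2 hx
  have hz0 : ∀ x ∉ Ω.carrier, z x = 0 := by
    intro x hx
    by_cases h : ∃ τ ∈ T.cells, x ∈ τ.closedInterior
    · simp only [z, dif_pos h]
      exact T.interp_eq_zero hc h.choose_spec.1 h.choose_spec.2 hx
    · simp only [z, dif_neg h]
  refine ⟨z, ⟨?_, hz0, fun τ hτ => ⟨Cell.interp τ c, hz τ hτ⟩⟩, hz⟩
  let f : Option T.cells → Set (E d) := fun o => o.elim Ω.carrierᶜ fun τ => τ.1.closedInterior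
  refine (locallyFinite_of_finite f).continuous ?_ ?_ ?_
  · refine eq_univ_of_forall fun x => ?_
    by_cases hx : x ∈ Ω.carrier
    · obtain ⟨τ, hτ, hxτ⟩ := T.exists_mem_cell (subset_closure hx)
      exact mem_iUnion.2 ⟨some ⟨τ, hτ⟩, hxτ⟩
    · exact mem_iUnion.2 ⟨none, hx⟩
  · rintro (_ | τ)
    · exact Ω.isOpen.isClosed_compl
    · exact (Cell.isCompact τ.1).isClosed
  · rintro (_ | τ)
    · exact continuousOn_const.congr hz0
    · exact (Cell.interp τ.1 c).continuous_of_finiteDimensional.continuousOn.congr (hz τ.1 τ.2)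

end Triangulation

theorem ConvexPolyhedralDomain.exists_supporting_normal (Ω : ConvexPolyhedralDomain d) {a : E d}
    (ha : a ∉ Ω.carrier) : ∃ n : E d, ‖n‖ = 1 ∧ ∀ x ∈ Ω.carrier, inner ℝ n x < inner ℝ n a := by
  obtain ⟨f, hf⟩ := geometric_hahn_banach_open_point Ω.convex Ω.isOpen ha
  set p := (InnerProductSpace.toDual ℝ (E d)).symm f
  have hp : ∀ x, inner ℝ p x = f x := fun x => InnerProductSpace.toDual_symm_apply
  have hp0 : p ≠ 0 := by
    intro h0
    obtain ⟨x, hx⟩ := Ω.nonempty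
    have := hf x hx
    rw [← hp, ← hp, h0, inner_zero_left, inner_zero_left] at this
    exact lt_irrefl _ this
  have hn : 0 < ‖p‖ := norm_pos_iff.2 hp0
  refine ⟨‖p‖⁻¹ • p, by rw [norm_smul, norm_inv, norm_norm, inv_mul_cancel₀ hn.ne'], fun x hx => ?_⟩
  rw [real_inner_smul_left, real_inner_smul_left, hp, hp]
  exact mul_lt_mul_of_pos_left (hf x hx) (inv_pos.2 hn)

namespace Triangulation

/-- The elements having `a` as a vertex. -/
noncomputable def star (T : Triangulation Ω) (a : E d) : Finset (Cell d) :=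
  open scoped Classical in T.cells.filter fun τ => a ∈ Cell.vertices τ

theorem mem_star {T : Triangulation Ω} {a : E d} {τ : Cell d} :
    τ ∈ T.star a ↔ τ ∈ T.cells ∧ a ∈ Cell.vertices τ := by
  classical
  simp [star]

theorem vertexPatch_eq (T : Triangulation Ω) (a : E d) :
    T.vertexPatch a = interior (⋃ τ ∈ T.star a, τ.closedInterior) := by
  simp only [vertexPatch, mem_star]; rfl

theorem vertexPatch_ae_eq (T : Triangulation Ω) (a : E d) :
    T.vertexPatch a =ᵐ[volume] ⋃ τ ∈ T.star a, τ.closedInterior := by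
  rw [vertexPatch_eq]
  have h0 : ∀ᵐ x, ∀ τ ∈ T.star a, x ∉ frontier τ.closedInterior := by
    refine (ae_ball_iff (T.star a).countable_toSet).2 fun τ _ => ?_
    exact measure_eq_zero_iff_ae_notMem.1 ((Cell.convex τ).addHaar_frontier volume)
  filter_upwards [h0] with x hx
  refine propext (show x ∈ interior (⋃ τ ∈ T.star a, τ.closedInterior) ↔
    x ∈ ⋃ τ ∈ T.star a, τ.closedInterior from ⟨fun h => interior_subset h, fun h => ?_⟩)
  obtain ⟨τ, hτ, hxτ⟩ := mem_iUnion₂.1 h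
  have : x ∈ interior τ.closedInterior := by
    by_contra hc
    exact hx τ hτ ⟨subset_closure hxτ, hc⟩
  exact interior_mono (subset_biUnion_of_mem (u := fun τ : Cell d => τ.closedInterior) hτ) this

variable {ρ σ : ℝ}

theorem meshSize_pos [NeZero d] {T : Triangulation Ω} (hT : T.IsQuasiUniform ρ σ) :
    0 < T.meshSize := by
  obtain ⟨τ, hτ⟩ := T.cells_nonempty
  exact (τ.inradius_pos.trans_le (Cell.inradius_le_cellDiam τ)).trans_le (hT.2.2 τ hτ).2.2

/-- The Poincaré inequality on a vertex patch, as sums over elements. -/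
theorem exists_sum_star_le [NeZero d] {T : Triangulation Ω} (hT : IsAdmissible T ρ σ)
    {w : E d → ℝ} {L : ℝ≥0} (hw : LipschitzWith L w) {a : E d} (ha : a ∈ T.vertices) :
    ∃ c, ∑ τ ∈ T.star a, ∫ x in τ.closedInterior, (w x - c) ^ 2 ≤
      2 * T.meshSize ^ 2 * ∑ τ ∈ T.star a, ∫ x in τ.closedInterior, ‖gradient w x‖ ^ 2 := by
  have hsub : T.star a ⊆ T.cells := fun τ hτ => (mem_star.1 hτ).1
  obtain ⟨c, hc⟩ := exists_integral_sub_sq_le_of_convex hw (hT.2 a ha)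
    isOpen_interior.measurableSet (a := a) (meshSize_pos hT.1) (by
      -- Every element of the star has diameter at most the mesh size and contains `a`, so the patch
      -- lies in the closed ball of that radius about `a`.
      rw [vertexPatch_eq]
      refine interior_subset.trans (iUnion₂_subset fun τ hτ x hx => ?_)
      obtain ⟨hτc, i, rfl⟩ := mem_star.1 hτ
      exact (Cell.dist_le_cellDiam τ hx (τ.point_mem_closedInterior i)).trans
        (hT.1.2.2 τ hτc).2.2)
  refine ⟨c, ?_⟩
  rw [setIntegral_congr_set (T.vertexPatch_ae_eq a), setIntegral_congr_set (T.vertexPatch_ae_eq a),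
    T.integral_biUnion hsub, T.integral_biUnion hsub] at hc
  · exact hc
  · exact fun τ _ => integrableOn_norm_gradient_sq hw (Cell.isBounded τ)
  · have := hw.continuous
    exact fun τ _ => integrableOn_of_continuous (by fun_prop) (Cell.isBounded τ)

/-- Double counting of incident vertex–element pairs. It turns patchwise estimates into elementwise
ones; for an `F` independent of the vertex every element is counted `d + 1` times. -/
theorem sum_cells_sum_points (T : Triangulation Ω) (F : Cell d → E d → ℝ) :
    ∃ V : Finset (E d), (∀ a, a ∈ V ↔ a ∈ T.vertices) ∧
      ∑ τ ∈ T.cells, ∑ i, F τ (τ.points i) = ∑ a ∈ V, ∑ τ ∈ T.star a, F τ a := by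
  classical
  let V : Finset (E d) := T.cells.biUnion fun τ => Finset.univ.image τ.points
  refine ⟨V, fun a => by simp [V, vertices, Cell.vertices], ?_⟩
  have h1 : ∀ τ ∈ T.cells, ∑ i, F τ (τ.points i) =
      ∑ a ∈ V, if a ∈ Cell.vertices τ then F τ a else 0 := by
    intro τ hτ
    rw [← Finset.sum_filter]
    have : V.filter (fun a => a ∈ Cell.vertices τ) = Finset.univ.image τ.points := by
      ext a
      simp only [V, Finset.mem_filter, Finset.mem_biUnion, Finset.mem_image, Finset.mem_univ,
        true_and, Cell.vertices, mem_range]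
      exact ⟨fun h => h.2, fun h => ⟨⟨τ, hτ, h⟩, h⟩⟩
    rw [this, Finset.sum_image fun i _ j _ h => τ.independent.injective h]
  rw [Finset.sum_congr rfl h1, Finset.sum_comm]
  refine Finset.sum_congr rfl fun a _ => ?_
  rw [star, Finset.sum_filter]

theorem sq_sub_sum_le {ι : Type*} [Fintype ι] {l : ι → ℝ} (h0 : ∀ i, 0 ≤ l i) (h1 : ∑ i, l i = 1)
    (b : ℝ) (c : ι → ℝ) : (b - ∑ i, l i * c i) ^ 2 ≤ ∑ i, l i * (b - c i) ^ 2 := by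
  have h2 : ConvexOn ℝ univ fun x : ℝ => x ^ 2 := even_two.convexOn_pow
  have h3 := h2.map_sum_le (t := Finset.univ) (w := l) (p := fun i => b - c i)
    (fun i _ => h0 i) h1 (fun i _ => mem_univ _)
  simp only [smul_eq_mul] at h3
  refine le_trans (le_of_eq ?_) h3
  congr 1
  simp_rw [mul_sub]
  rw [Finset.sum_sub_distrib, ← Finset.sum_mul, h1, one_mul]

/-- The approximation property of the finite element space, with an explicit constant. -/
theorem exists_feSpace_integral_sub_sq_le [NeZero d] {T : Triangulation Ω}
    (hT : IsAdmissible T ρ σ) {w : E d → ℝ} {L : ℝ≥0} (hw : LipschitzWith L w)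
    (hw0 : ∀ x ∉ Ω.carrier, w x = 0) :
    ∃ z ∈ T.feSpace, ∫ x in Ω.carrier, (w x - z x) ^ 2 ≤
      (2 * (d + 1) + 1) * T.meshSize ^ 2 * ∫ x in Ω.carrier, ‖gradient w x‖ ^ 2 := by
  classical
  have hh : 0 < T.meshSize := meshSize_pos hT.1
  set h := T.meshSize
  have hwc := hw.continuous
  have hΩm := Ω.isOpen.measurableSet
  -- Nodal values of the quasi-interpolant: the Poincaré constant of the patch at interior vertices,
  -- zero elsewhere so that the boundary condition holds.
  have hc : ∀ a : E d, ∃ c : ℝ, (a ∉ Ω.carrier → c = 0) ∧ (a ∈ T.vertices → a ∈ Ω.carrier →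
      ∑ τ ∈ T.star a, ∫ x in τ.closedInterior, (w x - c) ^ 2 ≤
        2 * h ^ 2 * ∑ τ ∈ T.star a, ∫ x in τ.closedInterior, ‖gradient w x‖ ^ 2) := by
    intro a
    by_cases ha : a ∈ T.vertices ∧ a ∈ Ω.carrier
    · obtain ⟨c, hc⟩ := exists_sum_star_le hT hw ha.1
      exact ⟨c, fun h => absurd ha.2 h, fun _ _ => hc⟩
    · exact ⟨0, fun _ => rfl, fun h1 h2 => absurd ⟨h1, h2⟩ ha⟩
  choose c hc0 hcP using hc
  obtain ⟨z, hz, hzτ⟩ := T.exists_interpolant hc0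
  refine ⟨z, hz, ?_⟩
  have hzc : Continuous z := hz.1
  let F : Cell d → E d → ℝ := fun τ a =>
    if a ∈ Ω.carrier then ∫ x in τ.closedInterior, (w x - c a) ^ 2 else 0
  obtain ⟨V, hV, hsum⟩ := T.sum_cells_sum_points F
  obtain ⟨V', hV', hsum'⟩ := T.sum_cells_sum_points fun τ _ =>
    ∫ x in τ.closedInterior, ‖gradient w x‖ ^ 2
  have hVV : V' = V := by ext a; rw [hV, hV']
  rw [hVV] at hsum'
  -- supporting hyperplanes at the boundary vertices
  have hN : ∀ a : E d, ∃ n : E d, a ∉ Ω.carrier →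
      ‖n‖ = 1 ∧ ∀ x ∈ Ω.carrier, inner ℝ n x < inner ℝ n a := fun a => by
    by_cases ha : a ∈ Ω.carrier
    · exact ⟨0, fun h => absurd ha h⟩
    · obtain ⟨n, hn⟩ := Ω.exists_supporting_normal ha
      exact ⟨n, fun _ => hn⟩
  choose N hN using hN
  let B : Finset (E d) := V.filter fun a => a ∉ Ω.carrier
  let e : Fin B.card ≃ B := B.equivFin.symm
  have heB : ∀ b, (e b : E d) ∉ Ω.carrier := fun b => (Finset.mem_filter.1 (e b).2).2
  have hstrip := integral_boundary_strip_le (n := fun b => N (e b))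
    (c := fun b => inner ℝ (N (e b)) (e b)) Ω hw hw0 (fun b => (hN _ (heB b)).1)
    (fun b => (hN _ (heB b)).2) hh
  set S := Ω.carrier ∩
    {x | ∃ b, inner ℝ (N (e b)) (e b : E d) - inner ℝ (N (e b)) x ≤ h} with hSdef
  have hSm : MeasurableSet S := by
    refine hΩm.inter ?_
    simp only [ofPred_exists]
    refine MeasurableSet.iUnion fun b => measurableSet_le (Continuous.measurable ?_)
      measurable_const
    fun_prop
  have iS : ∀ s : Set (E d), Bornology.IsBounded s →
      IntegrableOn (S.indicator fun x => w x ^ 2) s := fun s hs =>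
    IntegrableOn.indicator (integrableOn_of_continuous (hwc.pow 2) hs) hSm
  have icell : ∀ (τ : Cell d) (a : E d),
      IntegrableOn (fun x => (w x - c a) ^ 2) τ.closedInterior := fun τ a =>
    integrableOn_of_continuous (by fun_prop) (Cell.isBounded τ)
  have hcell : ∀ τ ∈ T.cells, ∫ x in τ.closedInterior, (w x - z x) ^ 2 ≤
      ∑ i, F τ (τ.points i) + ∫ x in τ.closedInterior, S.indicator (fun x => w x ^ 2) x := by
    intro τ hτ
    have hF : ∀ i, F τ (τ.points i) = ∫ x in τ.closedInterior,
        if τ.points i ∈ Ω.carrier then (w x - c (τ.points i)) ^ 2 else 0 := by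
      intro i
      by_cases hi : τ.points i ∈ Ω.carrier <;> simp [F, hi]
    have iF : ∀ i ∈ Finset.univ, IntegrableOn (fun x =>
        if τ.points i ∈ Ω.carrier then (w x - c (τ.points i)) ^ 2 else 0) τ.closedInterior := by
      intro i _
      by_cases hi : τ.points i ∈ Ω.carrier
      · simpa [hi] using icell τ (τ.points i)
      · simp [hi]
    simp_rw [hF]
    rw [← integral_finsetSum _ iF, ← integral_add (integrable_finsetSum _ iF)
      (iS _ (Cell.isBounded τ))]
    refine setIntegral_mono_on_ae
      (integrableOn_of_continuous (by fun_prop) (Cell.isBounded τ))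
      ((integrable_finsetSum _ iF).add (iS _ (Cell.isBounded τ))) (Cell.measurableSet τ) ?_
    rw [← ae_restrict_iff' (Cell.measurableSet τ)]
    filter_upwards [Cell.ae_mem_interior τ] with x hx
    have hxτ := interior_subset hx
    have hxΩ := Cell.interior_subset_carrier T hτ hx
    have hl0 : ∀ i, 0 ≤ (Cell.basis τ).coord i x := by
      have := hxτ; rwa [Cell.closedInterior_eq] at this
    have hl1 := (Cell.basis τ).sum_coord_apply_eq_one x
    have hl1' : ∀ i, (Cell.basis τ).coord i x ≤ 1 := fun i => by
      rw [← hl1]; exact Finset.single_le_sum (fun j _ => hl0 j) (Finset.mem_univ i)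
    -- If an element has a boundary vertex, its points in `Ω` are within `h` of that vertex and
    -- hence of the supporting hyperplane there.
    have hSx : ∀ i, τ.points i ∉ Ω.carrier → x ∈ S := by
      intro i hi
      have hiB : τ.points i ∈ B := Finset.mem_filter.2 ⟨(hV _).2
        (mem_iUnion₂.2 ⟨τ, hτ, ⟨i, rfl⟩⟩), hi⟩
      refine ⟨hxΩ, e.symm ⟨_, hiB⟩, ?_⟩
      rw [Equiv.apply_symm_apply, ← inner_sub_right]
      refine (real_inner_le_norm _ _).trans ?_
      rw [(hN _ hi).1, one_mul, ← dist_eq_norm]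
      exact (Cell.dist_le_cellDiam τ (τ.point_mem_closedInterior i) hxτ).trans
        (hT.1.2.2 τ hτ).2.2
    rw [hzτ τ hτ x hxτ, Cell.interp_apply]
    refine (sq_sub_sum_le hl0 hl1 _ _).trans ?_
    -- Barycentric weights are bounded by 1 at interior vertices but kept at boundary ones, where
    -- they sum to at most 1. The strip term thus enters only once, giving `2(d + 1) + 1` in the
    -- final constant.
    have hterm : ∀ i, (Cell.basis τ).coord i x * (w x - c (τ.points i)) ^ 2 ≤
        (if τ.points i ∈ Ω.carrier then (w x - c (τ.points i)) ^ 2 else 0) +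
          (Cell.basis τ).coord i x * S.indicator (fun x => w x ^ 2) x := by
      intro i
      have hind : 0 ≤ S.indicator (fun x => w x ^ 2) x := indicator_nonneg (fun _ _ => sq_nonneg _) x
      by_cases hi : τ.points i ∈ Ω.carrier
      · rw [if_pos hi]
        have := mul_le_mul_of_nonneg_right (hl1' i) (sq_nonneg (w x - c (τ.points i)))
        have := mul_nonneg (hl0 i) hind
        linarith
      · rw [if_neg hi, indicator_of_mem (hSx i hi), hc0 _ hi, sub_zero, zero_add]
    refine (Finset.sum_le_sum fun i _ => hterm i).trans_eq ?_
    rw [Finset.sum_add_distrib, ← Finset.sum_mul, hl1, one_mul]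
  have hgrad : ∫ x in Ω.carrier, ‖gradient w x‖ ^ 2 =
      ∑ τ ∈ T.cells, ∫ x in τ.closedInterior, ‖gradient w x‖ ^ 2 :=
    T.integral_eq_sum fun τ _ => integrableOn_norm_gradient_sq hw (Cell.isBounded τ)
  have hind : ∑ τ ∈ T.cells, ∫ x in τ.closedInterior, S.indicator (fun x => w x ^ 2) x =
      ∫ x in S, w x ^ 2 := by
    rw [← T.integral_eq_sum fun τ _ => iS _ (Cell.isBounded τ), setIntegral_indicator hSm,
      inter_eq_right.2 inter_subset_left]
  have hstar : ∀ a ∈ V, ∑ τ ∈ T.star a, F τ a ≤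
      2 * h ^ 2 * ∑ τ ∈ T.star a, ∫ x in τ.closedInterior, ‖gradient w x‖ ^ 2 := by
    intro a ha
    by_cases haΩ : a ∈ Ω.carrier
    · simp only [F, if_pos haΩ]
      exact hcP a ((hV a).1 ha) haΩ
    · simp only [F, if_neg haΩ, Finset.sum_const_zero]
      have : 0 ≤ ∑ τ ∈ T.star a, ∫ x in τ.closedInterior, ‖gradient w x‖ ^ 2 :=
        Finset.sum_nonneg fun τ _ => integral_nonneg fun _ => sq_nonneg _
      positivity
  calc ∫ x in Ω.carrier, (w x - z x) ^ 2
      = ∑ τ ∈ T.cells, ∫ x in τ.closedInterior, (w x - z x) ^ 2 :=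
        T.integral_eq_sum fun τ _ =>
          integrableOn_of_continuous (by fun_prop) (Cell.isBounded τ)
    _ ≤ ∑ τ ∈ T.cells, (∑ i, F τ (τ.points i) +
          ∫ x in τ.closedInterior, S.indicator (fun x => w x ^ 2) x) :=
        Finset.sum_le_sum hcell
    _ = ∑ a ∈ V, ∑ τ ∈ T.star a, F τ a + ∫ x in S, w x ^ 2 := by
        rw [Finset.sum_add_distrib, hsum, hind]
    _ ≤ ∑ a ∈ V, 2 * h ^ 2 * ∑ τ ∈ T.star a, (∫ x in τ.closedInterior, ‖gradient w x‖ ^ 2) +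
          h ^ 2 * ∫ x in Ω.carrier, ‖gradient w x‖ ^ 2 :=
        add_le_add (Finset.sum_le_sum hstar) hstrip
    _ = _ := by
        rw [← Finset.mul_sum, ← hsum', hgrad]
        simp only [Finset.sum_const, Finset.card_univ, Fintype.card_fin, nsmul_eq_mul]
        rw [← Finset.mul_sum]
        push_cast
        ring

end Triangulation

end Interpolation

end BPX

namespace BPX

/-! ### Orthogonality between levels and the interaction estimate -/

section CauchySchwarz

open scoped NNReal

variable {d : ℕ} {Ω : ConvexPolyhedralDomain d}

theorem Triangulation.IsRefinement.feSpace_le {T T' : Triangulation Ω} (h : T'.IsRefinement T) :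
    T.feSpace ≤ T'.feSpace := by
  rintro v ⟨hc, h0, hA⟩
  refine ⟨hc, h0, fun τ' hτ' => ?_⟩
  obtain ⟨τ, hτ, hsub⟩ := h τ' hτ'
  obtain ⟨A, hvA⟩ := hA τ hτ
  exact ⟨A, hvA.mono hsub⟩

theorem levelProj_of_pos (T : ℕ → Triangulation Ω) {J l : ℕ} (hl : 1 ≤ l) (u : (T J).feSpace) :
    levelProj T J l u = ((T l).l2Proj ((T J).toL2 u)).1 := by
  rw [levelProj, if_neg (by omega)]
  rfl

theorem levelProj_zero (T : ℕ → Triangulation Ω) (J : ℕ) (u : (T J).feSpace) :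
    levelProj T J 0 u = 0 := by
  rw [levelProj, if_pos rfl]
  rfl

/-- The spaces are nested by refinement; at `l = 1` the convention `Q_0 = 0` replaces any condition
on `T 0`. -/
theorem mem_feSpace_of_mem_levelRange {T : ℕ → Triangulation Ω} {J : ℕ}
    (hT : ∀ l, 2 ≤ l → l ≤ J → (T l).IsRefinement (T (l - 1))) {l : ℕ} (hl : 1 ≤ l) (hlJ : l ≤ J)
    {v : E d → ℝ} (hv : v ∈ levelRange T J l) : v ∈ (T l).feSpace := by
  obtain ⟨u, rfl⟩ := hv
  rw [LinearMap.sub_apply, levelProj_of_pos T hl]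
  refine Submodule.sub_mem _ (SetLike.coe_mem _) ?_
  rcases hl.eq_or_lt with rfl | hl1
  · rw [levelProj_zero]
    exact Submodule.zero_mem _
  · rw [levelProj_of_pos T (by omega)]
    exact (hT l hl1 hlJ).feSpace_le (SetLike.coe_mem _)

theorem integrableOn_carrier {g : E d → ℝ} (hg : Continuous g) : IntegrableOn g Ω.carrier :=
  integrableOn_of_continuous hg Ω.isBounded

/-- Since `z` belongs to both spaces, both projections of `u` have the same `L²` product with `z` as
`u` itself. At level 1 this fails, because `Q_0` is zero rather than a projection onto a space for
`T 0`. -/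
theorem integral_mul_eq_zero_of_mem_levelRange {T : ℕ → Triangulation Ω} {J : ℕ}
    (hT : ∀ l, 2 ≤ l → l ≤ J → (T l).IsRefinement (T (l - 1))) {k : ℕ} (hk : 2 ≤ k) (hkJ : k ≤ J)
    {w z : E d → ℝ} (hw : w ∈ levelRange T J k) (hz : z ∈ (T (k - 1)).feSpace) :
    ∫ x in Ω.carrier, w x * z x = 0 := by
  obtain ⟨u, rfl⟩ := hw
  rw [LinearMap.sub_apply, levelProj_of_pos T (by omega), levelProj_of_pos T (by omega)]
  have h1 := (T k).integral_l2Proj_mul (T J) u ⟨z, (hT k hk hkJ).feSpace_le hz⟩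
  have h2 := (T (k - 1)).integral_l2Proj_mul (T J) u ⟨z, hz⟩
  set p := (T k).l2Proj ((T J).toL2 u)
  set q := (T (k - 1)).l2Proj ((T J).toL2 u)
  have hp : Continuous p.1 := p.2.1
  have hq : Continuous q.1 := q.2.1
  have hzc : Continuous z := hz.1
  simp only [Pi.sub_apply, sub_mul]
  have i1 : IntegrableOn (fun x => p.1 x * z x) Ω.carrier := integrableOn_carrier (hp.mul hzc)
  have i2 : IntegrableOn (fun x => q.1 x * z x) Ω.carrier := integrableOn_carrier (hq.mul hzc)
  rw [integral_sub i1 i2]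
  exact sub_eq_zero.2 (h1.trans h2.symm)

/-- Orthogonality gives `‖w‖² = ∫ w (w - z) ≤ ‖w‖ ‖w - z‖`; the factor `3d` comes from `2(d + 1) + 1
≤ 9d²` for `d ≥ 1`. -/
theorem sqrt_integral_sq_le_of_mem_levelRange [NeZero d] {T : ℕ → Triangulation Ω} {J : ℕ}
    {ρ σ : ℝ} (hT : ∀ l, 2 ≤ l → l ≤ J → (T l).IsRefinement (T (l - 1))) {k : ℕ} (hk : 2 ≤ k)
    (hkJ : k ≤ J) (hadm : IsAdmissible (T (k - 1)) ρ σ) {w : E d → ℝ}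
    (hw : w ∈ levelRange T J k) :
    √(∫ x in Ω.carrier, w x ^ 2) ≤ 3 * d * (T (k - 1)).meshSize * h1Seminorm Ω w := by
  have hwV := mem_feSpace_of_mem_levelRange hT (by omega) hkJ hw
  obtain ⟨L, hL⟩ := (T k).exists_lipschitzWith hwV
  obtain ⟨z, hz, hwz⟩ :=
    Triangulation.exists_feSpace_integral_sub_sq_le hadm hL hwV.2.1
  have h0 := integral_mul_eq_zero_of_mem_levelRange hT hk hkJ hw hz
  have hwc := hL.continuous
  have hzc : Continuous z := hz.1
  have hd : (1 : ℝ) ≤ d := by exact_mod_cast NeZero.one_le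
  have hh := Triangulation.meshSize_pos hadm.1
  set h := (T (k - 1)).meshSize
  set a := √(∫ x in Ω.carrier, w x ^ 2)
  have ha : 0 ≤ a := Real.sqrt_nonneg _
  have h1 : a ^ 2 = ∫ x in Ω.carrier, w x * (w x - z x) := by
    rw [Real.sq_sqrt (integral_nonneg fun _ => sq_nonneg _)]
    simp_rw [mul_sub]
    rw [integral_sub (integrableOn_carrier (by fun_prop)) (integrableOn_carrier (by fun_prop)), h0,
      sub_zero]
    simp_rw [pow_two]
  have h2 : ∫ x in Ω.carrier, w x * (w x - z x) ≤ a * √(∫ x in Ω.carrier, (w x - z x) ^ 2) :=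
    integral_mul_le_sqrt_mul_sqrt (integrableOn_carrier (by fun_prop))
      (integrableOn_carrier (by fun_prop)) (integrableOn_carrier (by fun_prop))
  have h3 : √(∫ x in Ω.carrier, (w x - z x) ^ 2) ≤ 3 * d * h * h1Seminorm Ω w := by
    refine Real.sqrt_le_iff.2 ⟨mul_nonneg (by positivity) (Real.sqrt_nonneg _), hwz.trans ?_⟩
    have h4 : 0 ≤ ∫ x in Ω.carrier, ‖gradient w x‖ ^ 2 := integral_nonneg fun _ => sq_nonneg _
    rw [mul_pow, h1Seminorm, Real.sq_sqrt h4, mul_pow]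
    gcongr
    nlinarith
  refine le_trans ?_ h3
  rcases ha.eq_or_lt with ha0 | ha0
  · rw [← ha0]; exact Real.sqrt_nonneg _
  · rw [pow_two] at h1
    exact le_of_mul_le_mul_left (h1.trans_le h2) ha0

theorem dirichletForm_le_h1Seminorm_mul {v w : E d → ℝ} {L M : ℝ≥0} (hv : LipschitzWith L v)
    (hw : LipschitzWith M w) : dirichletForm Ω v w ≤ h1Seminorm Ω v * h1Seminorm Ω w := by
  have hvm := measurable_gradient v
  have hwm := measurable_gradient w
  have hprod : IntegrableOn (fun x => ‖gradient v x‖ * ‖gradient w x‖) Ω.carrier := by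
    refine integrableOn_of_norm_le Ω.isBounded (hvm.norm.mul hwm.norm).aestronglyMeasurable
      (C := L * M) (ae_of_all _ fun x => ?_)
    rw [Real.norm_eq_abs, abs_of_nonneg (by positivity)]
    exact mul_le_mul (norm_gradient_le hv x) (norm_gradient_le hw x) (norm_nonneg _) L.2
  have hinner : IntegrableOn (fun x => inner ℝ (gradient v x) (gradient w x)) Ω.carrier :=
    hprod.mono' (hvm.inner hwm).aestronglyMeasurable
      (ae_of_all _ fun x => abs_real_inner_le_norm _ _)
  exact (integral_mono hinner hprod fun x => real_inner_le_norm _ _).trans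
    (integral_mul_le_sqrt_mul_sqrt (integrableOn_norm_gradient_sq hv Ω.isBounded)
      (integrableOn_norm_gradient_sq hw Ω.isBounded) hprod)

/-- Interaction of a finite element function with an oscillating function: the gain `√(s / R)`
comes from the fact that only boundary strips of the elements contribute. -/
theorem Triangulation.dirichletForm_le [NeZero d] (T : Triangulation Ω) {v w : E d → ℝ} {L : ℝ≥0}
    (hv : v ∈ T.feSpace) (hw : LipschitzWith L w) {R s : ℝ} (hR : 0 < R)
    (hRr : ∀ τ ∈ T.cells, R ≤ τ.inradius) (hs : 0 < s)
    (hws : √(∫ x in Ω.carrier, w x ^ 2) ≤ s * h1Seminorm Ω w) :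
    dirichletForm Ω v w ≤ 2 * √(d * (s / R)) * h1Seminorm Ω v * h1Seminorm Ω w := by
  obtain ⟨M, hM⟩ := T.exists_lipschitzWith hv
  have hv0 : 0 ≤ h1Seminorm Ω v := Real.sqrt_nonneg _
  have hw0 : 0 ≤ h1Seminorm Ω w := Real.sqrt_nonneg _
  have hd : (1 : ℝ) ≤ d := by exact_mod_cast NeZero.one_le
  -- When the strip is as wide as the inradius bound, the claimed factor is at least 1 and plain
  -- Cauchy–Schwarz is enough.
  rcases le_or_gt R s with hRs | hsR
  · have h1 : 1 ≤ √(d * (s / R)) := by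
      rw [Real.one_le_sqrt]
      have : 1 ≤ s / R := (one_le_div hR).2 hRs
      nlinarith
    refine (dirichletForm_le_h1Seminorm_mul hM hw).trans ?_
    rw [mul_assoc]
    refine le_mul_of_one_le_left (mul_nonneg hv0 hw0) (by linarith)
  have hvm := measurable_gradient v
  have hwm := measurable_gradient w
  let nv : Cell d → ℝ := fun τ => √(∫ x in τ.closedInterior, ‖gradient v x‖ ^ 2)
  let nw : Cell d → ℝ := fun τ => √(∫ x in τ.closedInterior, ‖gradient w x‖ ^ 2)
  let mw : Cell d → ℝ := fun τ => √(∫ x in τ.closedInterior, w x ^ 2)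
  have hcell : ∀ τ ∈ T.cells, ∫ x in τ.closedInterior, inner ℝ (gradient v x) (gradient w x) ≤
      √(d * (s / R)) * (nv τ * nw τ + nv τ * mw τ / s) := by
    intro τ hτ
    obtain ⟨p, hp⟩ := T.exists_gradient_eq hv hτ
    have hr := hRr τ hτ
    have e1 : ∫ x in τ.closedInterior, inner ℝ (gradient v x) (gradient w x) =
        ∫ x in τ.closedInterior, inner ℝ p (gradient w x) := by
      refine integral_congr_ae ?_
      filter_upwards [Cell.ae_mem_interior τ] with x hx
      rw [hp x hx]
    have e2 : nv τ = ‖p‖ * √(volume.real τ.closedInterior) := by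
      have : ∫ x in τ.closedInterior, ‖gradient v x‖ ^ 2 =
          ∫ x in τ.closedInterior, ‖p‖ ^ 2 := by
        refine integral_congr_ae ?_
        filter_upwards [Cell.ae_mem_interior τ] with x hx
        rw [hp x hx]
      simp only [nv]
      rw [this, setIntegral_const, smul_eq_mul, mul_comm, Real.sqrt_mul (sq_nonneg _),
        Real.sqrt_sq (norm_nonneg _)]
    have h := integral_inner_gradient_le (Cell.isCompact τ) (Cell.convex τ) hs (hsR.trans_le hr)
      (Cell.ball_incenter_subset τ) hw p
    rw [e1]
    refine h.trans ?_
    change ‖p‖ * √(volume.real τ.closedInterior * (d * (s / τ.inradius))) * (nw τ + mw τ / s) ≤ _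
    have e3 : √(volume.real τ.closedInterior * (d * (s / τ.inradius))) ≤
        √(volume.real τ.closedInterior) * √(d * (s / R)) := by
      rw [← Real.sqrt_mul measureReal_nonneg]
      gcongr
    have hnw : 0 ≤ nw τ + mw τ / s :=
      add_nonneg (Real.sqrt_nonneg _) (div_nonneg (Real.sqrt_nonneg _) hs.le)
    calc _ ≤ ‖p‖ * (√(volume.real τ.closedInterior) * √(d * (s / R))) * (nw τ + mw τ / s) := by
          gcongr
      _ = _ := by rw [e2]; ring
  have hsq : ∀ (g : E d → ℝ), (∀ x, 0 ≤ g x) → (∀ τ ∈ T.cells, IntegrableOn g τ.closedInterior) →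
      ∑ τ ∈ T.cells, √(∫ x in τ.closedInterior, g x) ^ 2 = ∫ x in Ω.carrier, g x := by
    intro g hg hgi
    rw [T.integral_eq_sum hgi]
    exact Finset.sum_congr rfl fun τ _ => Real.sq_sqrt (integral_nonneg hg)
  have hnv : ∑ τ ∈ T.cells, nv τ ^ 2 = ∫ x in Ω.carrier, ‖gradient v x‖ ^ 2 :=
    hsq _ (fun _ => sq_nonneg _) fun τ _ => integrableOn_norm_gradient_sq hM (Cell.isBounded τ)
  have hnw : ∑ τ ∈ T.cells, nw τ ^ 2 = ∫ x in Ω.carrier, ‖gradient w x‖ ^ 2 :=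
    hsq _ (fun _ => sq_nonneg _) fun τ _ => integrableOn_norm_gradient_sq hw (Cell.isBounded τ)
  have hmw : ∑ τ ∈ T.cells, mw τ ^ 2 = ∫ x in Ω.carrier, w x ^ 2 :=
    hsq _ (fun _ => sq_nonneg _) fun τ _ =>
      integrableOn_of_continuous (hw.continuous.pow 2) (Cell.isBounded τ)
  have hinner : ∀ τ ∈ T.cells,
      IntegrableOn (fun x => inner ℝ (gradient v x) (gradient w x)) τ.closedInterior := by
    intro τ _
    refine integrableOn_of_norm_le (Cell.isBounded τ) (hvm.inner hwm).aestronglyMeasurable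
      (C := M * L) (ae_of_all _ fun x => (abs_real_inner_le_norm _ _).trans ?_)
    exact mul_le_mul (norm_gradient_le hM x) (norm_gradient_le hw x) (norm_nonneg _) M.2
  have hcs1 := Real.sum_mul_le_sqrt_mul_sqrt T.cells nv nw
  have hcs2 := Real.sum_mul_le_sqrt_mul_sqrt T.cells nv mw
  rw [hnv, hnw] at hcs1
  rw [hnv, hmw] at hcs2
  calc dirichletForm Ω v w
      = ∑ τ ∈ T.cells, ∫ x in τ.closedInterior, inner ℝ (gradient v x) (gradient w x) :=
        T.integral_eq_sum hinner
    _ ≤ ∑ τ ∈ T.cells, √(d * (s / R)) * (nv τ * nw τ + nv τ * mw τ / s) :=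
        Finset.sum_le_sum hcell
    _ = √(d * (s / R)) * (∑ τ ∈ T.cells, nv τ * nw τ + (∑ τ ∈ T.cells, nv τ * mw τ) / s) := by
        rw [← Finset.mul_sum, Finset.sum_add_distrib, Finset.sum_div]
    _ ≤ √(d * (s / R)) * (h1Seminorm Ω v * h1Seminorm Ω w +
          h1Seminorm Ω v * (s * h1Seminorm Ω w) / s) := by
        have h5 : ∑ τ ∈ T.cells, nv τ * mw τ ≤ h1Seminorm Ω v * (s * h1Seminorm Ω w) :=
          hcs2.trans (mul_le_mul_of_nonneg_left hws hv0)
        have h6 : ∑ τ ∈ T.cells, nv τ * nw τ ≤ h1Seminorm Ω v * h1Seminorm Ω w := hcs1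
        gcongr
    _ = _ := by field_simp; ring

/-- Any one element forces both bounds, since `r_τ ≤ h_τ ≤ ρ r_τ` and `σ h ≤ h_τ ≤ h`. -/
theorem Triangulation.IsQuasiUniform.one_le_and_le_one [NeZero d] {T : Triangulation Ω} {ρ σ : ℝ}
    (hT : T.IsQuasiUniform ρ σ) : 1 ≤ ρ ∧ σ ≤ 1 := by
  obtain ⟨τ, hτ⟩ := T.cells_nonempty
  obtain ⟨h1, h2, h3⟩ := hT.2.2 τ hτ
  have hr := Cell.inradius_le_cellDiam τ
  have hr0 := τ.inradius_pos
  have hh := Triangulation.meshSize_pos hT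
  exact ⟨by nlinarith, by nlinarith⟩

theorem Triangulation.IsQuasiUniform.le_inradius [NeZero d] {T : Triangulation Ω} {ρ σ : ℝ}
    (hT : T.IsQuasiUniform ρ σ) {τ : Cell d} (hτ : τ ∈ T.cells) :
    σ * T.meshSize / ρ ≤ τ.inradius := by
  obtain ⟨h1, h2, -⟩ := hT.2.2 τ hτ
  rw [div_le_iff₀ hT.1, mul_comm τ.inradius]
  exact h2.trans h1

/-- The argument yields only `√(ρ / σ)`; because `ρ / σ ≥ 1`, raising the exponent to `3/2` weakens
the bound to the stated form. -/
theorem rpow_mul_rpow_neg_bounds {ρ σ : ℝ} (hρ : 1 ≤ ρ) (hσ : 0 < σ) (hσ1 : σ ≤ 1) :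
    1 ≤ ρ ^ (3 / 2 : ℝ) * σ ^ (-(3 / 2) : ℝ) ∧
      √(ρ / σ) ≤ ρ ^ (3 / 2 : ℝ) * σ ^ (-(3 / 2) : ℝ) := by
  have h1 : 1 ≤ ρ / σ := (one_le_div hσ).2 (hσ1.trans hρ)
  have h2 : ρ ^ (3 / 2 : ℝ) * σ ^ (-(3 / 2) : ℝ) = (ρ / σ) ^ (3 / 2 : ℝ) := by
    rw [Real.div_rpow (by linarith) hσ.le, Real.rpow_neg hσ.le]
    exact (div_eq_mul_inv _ _).symm
  rw [h2]
  refine ⟨Real.one_le_rpow h1 (by norm_num), ?_⟩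
  rw [Real.sqrt_eq_rpow]
  exact Real.rpow_le_rpow_of_exponent_le h1 (by norm_num)

end CauchySchwarz

end BPX

/-! ### The strengthened Cauchy–Schwarz inequality -/

theorem mainTheorem9 (c₁ c₂ : ℝ) (hc₁ : 0 < c₁) (hc₂ : 0 < c₂) :
    ∃ C : ℝ, 0 < C ∧
      ∀ (d : ℕ) [NeZero d] (Ω : BPX.ConvexPolyhedralDomain d) (ρ σ γ : ℝ) (J : ℕ)
        (T : ℕ → BPX.Triangulation Ω),
        γ ∈ Set.Ioo (0 : ℝ) 1 →
        (∀ l, 1 ≤ l → l ≤ J → BPX.IsAdmissible (T l) ρ σ) →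
        BPX.IsMultilevel T J γ c₁ c₂ →
        ∀ l k : ℕ, 1 ≤ l → l ≤ k → k ≤ J →
          ∀ v ∈ BPX.levelRange T J l, ∀ w ∈ BPX.levelRange T J k,
            BPX.dirichletForm Ω v w ≤
              C * ρ ^ (3 / 2 : ℝ) * σ ^ (-(3 / 2) : ℝ) * (d : ℝ) ^ 3 *
                γ ^ ((k : ℤ) - (l : ℤ) - 2) *
                BPX.h1Seminorm Ω v * BPX.h1Seminorm Ω w := by
  set κ := √(c₂ / c₁)
  have hκ : 0 ≤ κ := Real.sqrt_nonneg _
  -- The summand 1 serves the case `l = k`, the summand `4 * κ` the case `l < k`.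
  refine ⟨1 + 4 * κ, by positivity, ?_⟩
  intro d _ Ω ρ σ γ J T hγ hadm hml l k hl hlk hkJ v hv w hw
  obtain ⟨hγ0, hγ1⟩ := hγ
  have hvV := BPX.mem_feSpace_of_mem_levelRange hml.1 hl (hlk.trans hkJ) hv
  have hwV := BPX.mem_feSpace_of_mem_levelRange hml.1 (hl.trans hlk) hkJ hw
  obtain ⟨L, hL⟩ := (T l).exists_lipschitzWith hvV
  obtain ⟨M, hM⟩ := (T k).exists_lipschitzWith hwV
  have hadml := hadm l hl (hlk.trans hkJ)
  obtain ⟨hρ1, hσ1⟩ := hadml.1.one_le_and_le_one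
  have hρ0 : 0 < ρ := hadml.1.1
  have hσ0 : 0 < σ := hadml.1.2.1
  obtain ⟨hq1, hq2⟩ := BPX.rpow_mul_rpow_neg_bounds hρ1 hσ0 hσ1
  have hd : (1 : ℝ) ≤ d := by exact_mod_cast NeZero.one_le
  have hv0 : 0 ≤ BPX.h1Seminorm Ω v := Real.sqrt_nonneg _
  have hw0 : 0 ≤ BPX.h1Seminorm Ω w := Real.sqrt_nonneg _
  rw [mul_assoc (1 + 4 * κ)]
  set q := ρ ^ (3 / 2 : ℝ) * σ ^ (-(3 / 2) : ℝ)
  rcases hlk.eq_or_lt with rfl | hlk'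
  · refine (BPX.dirichletForm_le_h1Seminorm_mul hL hM).trans ?_
    rw [mul_assoc _ (BPX.h1Seminorm Ω v)]
    refine le_mul_of_one_le_left (mul_nonneg hv0 hw0) ?_
    have h1 : (1 : ℝ) ≤ γ ^ ((l : ℤ) - (l : ℤ) - 2) := by
      rw [sub_self, zero_sub]
      exact one_le_zpow_of_nonpos₀ hγ0 hγ1.le (by norm_num)
    have h2 : (1 : ℝ) ≤ (d : ℝ) ^ 3 := one_le_pow₀ hd
    have h3 : 1 ≤ 1 + 4 * κ := by linarith
    exact one_le_mul_of_one_le_of_one_le (one_le_mul_of_one_le_of_one_le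
      (one_le_mul_of_one_le_of_one_le h3 hq1) h2) h1
  -- The approximation takes place on level `k - 1 = l + m ≥ 1`, so the final decay is `γ ^ m = γ ^
  -- (k - l - 1)`, one power better than needed.
  · obtain ⟨m, rfl⟩ : ∃ m, k = l + 1 + m := ⟨k - l - 1, by omega⟩
    have hk1 : l + 1 + m - 1 = l + m := by omega
    have hjac := BPX.sqrt_integral_sq_le_of_mem_levelRange hml.1 (by omega) hkJ
      (hadm _ (by omega) (by omega)) hw
    rw [hk1] at hjac
    have hhl := BPX.Triangulation.meshSize_pos hadml.1
    have hhk := BPX.Triangulation.meshSize_pos (hadm (l + m) (by omega) (by omega)).1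
    have hbl := (hml.2 l hl (by omega)).1
    have hbk := (hml.2 (l + m) (by omega) (by omega)).2
    set hl' := (T l).meshSize
    set hk' := (T (l + m)).meshSize
    have hmain := (T l).dirichletForm_le hvV hM (R := σ * hl' / ρ) (s := 3 * d * hk')
      (by positivity) (fun τ hτ => hadml.1.le_inradius hτ) (by positivity) hjac
    refine hmain.trans ?_
    -- One factor `d` under the root comes from the strip volume, the other from the approximation
    -- constant; `√3` is rounded up to 2.
    have hsqrt : √(d * (3 * d * hk' / (σ * hl' / ρ))) ≤ 2 * d * (κ * √(ρ / σ) * γ ^ m) := by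
      refine Real.sqrt_le_iff.2 ⟨by positivity, ?_⟩
      have e1 : (2 * d * (κ * √(ρ / σ) * γ ^ m)) ^ 2 =
          4 * d ^ 2 * (c₂ / c₁ * (ρ / σ) * γ ^ (2 * m)) := by
        rw [mul_pow, mul_pow, mul_pow, mul_pow, Real.sq_sqrt (by positivity),
          Real.sq_sqrt (by positivity), ← pow_mul, mul_comm m 2]
        ring
      have e2 : (d : ℝ) * (3 * d * hk' / (σ * hl' / ρ)) = 3 * d ^ 2 * (hk' / hl' * (ρ / σ)) := by
        field_simp
      have e3 : hk' / hl' ≤ c₂ / c₁ * γ ^ (2 * m) := by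
        rw [div_le_iff₀ hhl]
        calc hk' ≤ c₂ * γ ^ (2 * (l + m)) := hbk
          _ = c₂ / c₁ * γ ^ (2 * m) * (c₁ * γ ^ (2 * l)) := by
              rw [mul_add, pow_add]; field_simp
          _ ≤ _ := by gcongr
      rw [e1, e2]
      calc 3 * (d : ℝ) ^ 2 * (hk' / hl' * (ρ / σ))
          ≤ 4 * d ^ 2 * (c₂ / c₁ * γ ^ (2 * m) * (ρ / σ)) := by gcongr; norm_num
        _ = _ := by ring
    have hzpow : γ ^ m ≤ γ ^ (((l + 1 + m : ℕ) : ℤ) - (l : ℤ) - 2) := by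
      rw [← zpow_natCast]
      exact zpow_le_zpow_right_of_le_one₀ hγ0 hγ1.le (by push_cast; linarith)
    have hd3 : (d : ℝ) ≤ (d : ℝ) ^ 3 := le_self_pow₀ hd (by norm_num)
    have hq0 : 0 ≤ q := by linarith
    have hz0 : 0 ≤ γ ^ (((l + 1 + m : ℕ) : ℤ) - (l : ℤ) - 2) := (zpow_pos hγ0 _).le
    refine mul_le_mul_of_nonneg_right (mul_le_mul_of_nonneg_right ?_ hv0) hw0
    calc 2 * √(d * (3 * d * hk' / (σ * hl' / ρ)))
        ≤ 2 * (2 * d * (κ * √(ρ / σ) * γ ^ m)) := by gcongr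
      _ = 4 * κ * √(ρ / σ) * d * γ ^ m := by ring
      _ ≤ (1 + 4 * κ) * q * (d : ℝ) ^ 3 * γ ^ (((l + 1 + m : ℕ) : ℤ) - (l : ℤ) - 2) := by
          gcongr
          linarith
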